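/- Let $\mathbb K$ be a field of characteristic $0$ and let $\mathbf C$ be the category of commutative associative (non-unital) $\mathbb Z$-graded differential $\mathbb K$-algebras $A$ (with $ab=(-1)^{\deg a\deg b}ba$, $d$ a derivation of degree $1$, $d^2=0$) which are nilpotent and finite dimensional over $\mathbb K$. An acyclic small extension in $\mathbf C$ is a surjective morphism $p:A\to B$ whose kernel $I$ satisfies $AI=0$ and is an acyclic complex. A functor $F:\mathbf C\to\mathbf{Set}$ is called a predeformation functor if 1. $F(0)$ is a one-point set; 2. for all morphisms $\alpha:A\to C$, $\beta:B\to C$ in $\mathbf C$ with $\alpha$ surjective, the map $F(A\times_C B)\to F(A)\times_{F(C)}F(B)$ is surjective, and it is bijective if moreover $C$ has trivial multiplication and is acyclic; 3. for every acyclic small extension $A\to B$ the map $F(A)\to F(B)$ is surjective. It is called a deformation functor if in addition the maps in 3 are all bijective. For $A\in\mathbf C$ and a real number $\epsilon>0$ put $$A[t,dt]_\epsilon=A\oplus\bigoplus_{n>0}A^{\lceil n\epsilon\rceil}\otimes(\mathbb Kt^n\oplus\mathbb Kt^{n-1}dt)\subset A\otimes\mathbb K[t,dt],$$ an object of $\mathbf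 C$, with evaluations $e_0,e_1:A[t,dt]_\epsilon\to A$ at $t=0$ and $t=1$ (and $dt=0$). **Theorem 2.8.** Let $F$ be a predeformation functor. Then there exist a deformation functor $F^+$ and a natural transformation $\eta:F\to F^+$ such that for every deformation functor $G$ and every natural transformation $\phi:F\to G$ there exists a unique natural transformation $\psi:F^+\to G$ with $\phi=\psi\eta$. Moreover, for every $A\in\mathbf C$, the map $\eta_A:F(A)\to F^+(A)$ is the quotient map by the equivalence relation generated by: $a\sim b$ if there are $\epsilon>0$ and $x\in F(A[t,dt]_\epsilon)$ with $e_0(x)=a$ and $e_1(x)=b$. That is, $\eta_A$ is surjective, and $\eta_A(a)=\eta_A(b)$ if and only if $a$ and $b$ are equivalent under this relation. -/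

import Mathlib

open CategoryTheory

universe u w

noncomputable section

/-- A (not necessarily unital) commutative, associative differential `ℤ`-graded algebra over `K`:
an associative `K`-algebra which is the internal direct sum of the subspaces `gr i`, graded
commutative, with a derivation `d` of degree `1` and square `0`. -/
structure DGAlg (K : Type u) [Field K] : Type (u + 1) where
  carrier : Type u
  [ring : NonUnitalRing carrier]
  [module : Module K carrier]
  [tower : IsScalarTower K carrier carrier]
  [smulComm : SMulCommClass K carrier carrier]
  gr : ℤ → Submodule K carrier
  isInternal : DirectSum.IsInternal gr
  mul_mem : ∀ {i j : ℤ} {a b : carrier}, a ∈ gr i → b ∈ gr j → a * b ∈ gr (i + j)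
  comm : ∀ {i j : ℤ} {a b : carrier}, a ∈ gr i → b ∈ gr j →
    a * b = (i * j).negOnePow • (b * a)
  d : carrier →ₗ[K] carrier
  d_mem : ∀ {i : ℤ} {a : carrier}, a ∈ gr i → d a ∈ gr (i + 1)
  d_d : ∀ a : carrier, d (d a) = 0
  leibniz : ∀ {i : ℤ} {a : carrier} (b : carrier), a ∈ gr i →
    d (a * b) = d a * b + i.negOnePow • (a * d b)

namespace DGAlg

variable {K : Type u} [Field K]

instance : CoeSort (DGAlg K) (Type u) := ⟨DGAlg.carrier⟩

attribute [instance] DGAlg.ring DGAlg.module DGAlg.tower DGAlg.smulComm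

/-- Morphisms of differential graded algebras. -/
@[ext]
structure Hom (A B : DGAlg K) extends A →ₙₐ[K] B where
  map_gr : ∀ {i : ℤ} {a : A}, a ∈ A.gr i → toNonUnitalAlgHom a ∈ B.gr i
  map_d : ∀ a : A, toNonUnitalAlgHom (A.d a) = B.d (toNonUnitalAlgHom a)

instance (A B : DGAlg K) : CoeFun (Hom A B) (fun _ => A → B) := ⟨fun f => f.toNonUnitalAlgHom⟩

/-- The identity morphism. -/
def Hom.id (A : DGAlg K) : Hom A A where
  toNonUnitalAlgHom := NonUnitalAlgHom.id K A
  map_gr := fun h => h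
  map_d := fun _ => rfl

/-- Composition of morphisms, in diagrammatic order. -/
def Hom.comp {A B C : DGAlg K} (f : Hom A B) (g : Hom B C) : Hom A C where
  toNonUnitalAlgHom := g.toNonUnitalAlgHom.comp f.toNonUnitalAlgHom
  map_gr := fun h => g.map_gr (f.map_gr h)
  map_d := fun a => (congrArg g (f.map_d a)).trans (g.map_d (f a))

/-- The ideal `A ^ n` spanned by the products of `n` elements of `A`, for `n ≥ 1`
(with the convention `A ^ 0 = A`, as `A` need not have a unit). -/
def pow (A : DGAlg K) : ℕ → Submodule K A
  | 0 => ⊤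
  | 1 => ⊤
  | n + 2 => Submodule.span K {x | ∃ a ∈ pow A (n + 1), ∃ b, x = a * b}

/-- The decomposition of `A` into its homogeneous components. -/
def decomp (A : DGAlg K) : A ≃ₗ[K] DirectSum ℤ fun i => A.gr i :=
  (LinearEquiv.ofBijective (DirectSum.coeLinearMap A.gr) A.isInternal).symm

/-- The projection of `A` onto its component of degree `i`. -/
def proj (A : DGAlg K) (i : ℤ) : A →ₗ[K] A :=
  (A.gr i).subtype ∘ₗ DirectSum.component K ℤ (fun j => A.gr j) i ∘ₗ
    A.decomp.toLinearMap

/-- The linear map which is multiplication by `(-1) ^ i` in degree `i`. -/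
def sgn (A : DGAlg K) : A →ₗ[K] A :=
  (DirectSum.toModule K ℤ A fun i => (i.negOnePow : ℤ) • (A.gr i).subtype) ∘ₗ
    A.decomp.toLinearMap

section lemmas

variable (A : DGAlg K)

theorem symm_of_mem {i : ℤ} {a : A} (h : a ∈ A.gr i) :
    A.decomp a =
      DirectSum.lof K ℤ (fun j => A.gr j) i ⟨a, h⟩ := by
  rw [decomp, LinearEquiv.symm_apply_eq]
  exact (DirectSum.coeLinearMap_lof A.gr i ⟨a, h⟩).symm

theorem proj_mem (i : ℤ) (a : A) : A.proj i a ∈ A.gr i := by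
  simp only [proj, LinearMap.comp_apply]
  exact Subtype.prop _

theorem proj_same {i : ℤ} {a : A} (h : a ∈ A.gr i) : A.proj i a = a := by
  simp [proj, A.symm_of_mem h, DirectSum.component.lof_self]

theorem proj_ne {i j : ℤ} {a : A} (h : a ∈ A.gr j) (hij : j ≠ i) : A.proj i a = 0 := by
  simp [proj, A.symm_of_mem h, DirectSum.component.of, hij]

theorem sgn_of_mem {i : ℤ} {a : A} (h : a ∈ A.gr i) : A.sgn a = i.negOnePow • a := by
  simp [sgn, A.symm_of_mem h, DirectSum.toModule_lof, Units.smul_def]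

theorem gr_induction {p : A → Prop} (a : A) (h0 : p 0) (hadd : ∀ x y, p x → p y → p (x + y))
    (hgr : ∀ (i : ℤ) (x : A), x ∈ A.gr i → p x) : p a := by
  have ha : a ∈ ⨆ i, A.gr i := by rw [A.isInternal.submodule_iSup_eq_top]; trivial
  exact Submodule.iSup_induction A.gr (motive := p) ha hgr h0 hadd

theorem proj_finite (a : A) : {i : ℤ | A.proj i a ≠ 0}.Finite := by
  induction a using A.gr_induction with
  | h0 => simp
  | hadd x y hx hy =>
    refine (hx.union hy).subset fun i hi => ?_
    by_contra h
    simp only [Set.mem_union, Set.mem_ofPred_eq, not_or, not_not] at h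
    exact hi (by rw [map_add, h.1, h.2, add_zero])
  | hgr j x hx =>
    refine (Set.finite_singleton j).subset fun i hi => ?_
    by_contra h
    exact hi (A.proj_ne hx (Ne.symm h))

theorem eq_zero_of_proj {a : A} (h : ∀ i, A.proj i a = 0) : a = 0 := by
  have : A.decomp a = 0 := by
    ext i
    exact h i
  simpa using this

/-- A family of compatible projections exhibits an internal direct sum. -/
theorem isInternal_of_proj {M : Type u} [AddCommGroup M] [Module K M] (gr : ℤ → Submodule K M)
    (π : ℤ → M →ₗ[K] M) (hmem : ∀ i x, π i x ∈ gr i) (hsame : ∀ i, ∀ x ∈ gr i, π i x = x)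
    (hne : ∀ i j, j ≠ i → ∀ x ∈ gr j, π i x = 0) (hfin : ∀ x, {i | π i x ≠ 0}.Finite)
    (hzero : ∀ x, (∀ i, π i x = 0) → x = 0) : DirectSum.IsInternal gr := by
  rw [DirectSum.isInternal_submodule_iff_iSupIndep_and_iSup_eq_top]
  constructor
  · intro i
    rw [Submodule.disjoint_def]
    intro x hx hx'
    have h1 : ⨆ j, ⨆ (_ : j ≠ i), gr j ≤ LinearMap.ker (π i) :=
      iSup_le fun j => iSup_le fun hj y hy => hne i j hj y hy
    rw [← hsame i x hx]
    exact h1 hx'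
  · rw [eq_top_iff]
    intro x _
    have hx : x = ∑ i ∈ (hfin x).toFinset, π i x := by
      rw [← sub_eq_zero]
      refine hzero _ fun i => ?_
      rw [map_sub, map_sum, sub_eq_zero]
      by_cases hi : π i x = 0
      · rw [hi, Finset.sum_eq_zero]
        intro j _
        by_cases hji : j = i
        · rw [hji, hi, map_zero]
        · exact hne i j hji _ (hmem j x)
      · rw [Finset.sum_eq_single i]
        · exact (hsame i _ (hmem i x)).symm
        · intro j _ hji
          exact hne i j hji _ (hmem j x)
        · intro h
          simp at h
          exact absurd h hi
    rw [hx]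
    exact Submodule.sum_mem _ fun i _ => Submodule.mem_iSup_of_mem i (hmem i x)

theorem sgn_sgn (a : A) : A.sgn (A.sgn a) = a := by
  induction a using A.gr_induction with
  | h0 => simp
  | hadd x y hx hy => simp [hx, hy]
  | hgr i x hx =>
    rw [A.sgn_of_mem hx, Units.smul_def, map_zsmul, A.sgn_of_mem hx, Units.smul_def, smul_smul,
      ← Units.val_mul, Int.units_mul_self, Units.val_one, one_smul]

theorem sgn_mul (a b : A) : A.sgn (a * b) = A.sgn a * A.sgn b := by
  induction a using A.gr_induction with
  | h0 => simp
  | hadd x y hx hy => simp [add_mul, hx, hy]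
  | hgr i x hx =>
    induction b using A.gr_induction with
    | h0 => simp
    | hadd y z hy hz => simp [mul_add, hy, hz]
    | hgr j y hy =>
      rw [A.sgn_of_mem hx, A.sgn_of_mem hy, A.sgn_of_mem (A.mul_mem hx hy), Int.negOnePow_add]
      simp only [Units.smul_def, smul_mul_assoc, mul_smul_comm, smul_smul, Units.val_mul]
      rw [mul_comm]

theorem sgn_d (a : A) : A.sgn (A.d a) = -A.d (A.sgn a) := by
  induction a using A.gr_induction with
  | h0 => simp
  | hadd x y hx hy => simp [hx, hy]; abel
  | hgr i x hx =>
    rw [A.sgn_of_mem hx, A.sgn_of_mem (A.d_mem hx), Int.negOnePow_succ]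
    simp only [Units.smul_def, map_zsmul, Units.val_neg, neg_smul]

theorem d_mul (a b : A) : A.d (a * b) = A.d a * b + A.sgn a * A.d b := by
  induction a using A.gr_induction with
  | h0 => simp
  | hadd x y hx hy => simp only [add_mul, map_add, hx, hy]; abel
  | hgr i x hx =>
    rw [A.sgn_of_mem hx, A.leibniz b hx]
    simp only [Units.smul_def, smul_mul_assoc]

theorem sgn_mem {i : ℤ} {a : A} (h : a ∈ A.gr i) : A.sgn a ∈ A.gr i := by
  rw [A.sgn_of_mem h, Units.smul_def]
  exact zsmul_mem h _

theorem Hom.map_proj {A B : DGAlg K} (f : Hom A B) (i : ℤ) (a : A) :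
    f (A.proj i a) = B.proj i (f a) := by
  induction a using A.gr_induction with
  | h0 => simp
  | hadd x y hx hy => simp [hx, hy]
  | hgr j x hx =>
    by_cases h : j = i
    · subst h
      rw [A.proj_same hx, B.proj_same (f.map_gr hx)]
    · rw [A.proj_ne hx h, B.proj_ne (f.map_gr hx) h, map_zero]

theorem mul_mem_pow_succ {n : ℕ} {a : A} (b : A) (h : a ∈ A.pow n) : a * b ∈ A.pow (n + 1) := by
  cases n with
  | zero => exact Submodule.mem_top
  | succ n => exact Submodule.subset_span ⟨a, h, b, rfl⟩

theorem pow_induction {p : ℕ → A → Prop} (h0 : ∀ a, p 0 a) (h1 : ∀ a, p 1 a)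
    (hmul : ∀ n, ∀ a ∈ A.pow (n + 1), p (n + 1) a → ∀ b, p (n + 2) (a * b))
    (hadd : ∀ n a b, p n a → p n b → p n (a + b))
    (hsmul : ∀ n (c : K) a, p n a → p n (c • a)) :
    ∀ n, ∀ a ∈ A.pow n, p n a
  | 0, a, _ => h0 a
  | 1, a, _ => h1 a
  | n + 2, a, ha => by
    refine Submodule.span_induction (p := fun x _ => p (n + 2) x) ?_ ?_
      (fun x y _ _ => hadd _ x y) (fun c x _ => hsmul _ c x) ha
    · rintro _ ⟨x, hx, y, rfl⟩
      exact hmul n x hx (pow_induction h0 h1 hmul hadd hsmul (n + 1) x hx) y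
    · simpa using hsmul (n + 2) 0 _ (hmul n 0 (zero_mem _)
        (pow_induction h0 h1 hmul hadd hsmul (n + 1) 0 (zero_mem _)) 0)

theorem pow_succ_le (n : ℕ) : A.pow (n + 1) ≤ A.pow n := by
  intro a ha
  have : ∀ n, ∀ a ∈ A.pow n, a ∈ A.pow (n - 1) := by
    refine A.pow_induction (p := fun n a => a ∈ A.pow (n - 1)) (fun _ => Submodule.mem_top)
      (fun _ => Submodule.mem_top) (fun n a _ ih b => ?_) (fun n a b ha hb => add_mem ha hb)
      (fun n c a ha => Submodule.smul_mem _ c ha)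
    exact A.mul_mem_pow_succ b ih
  exact this _ a ha

theorem pow_antitone : Antitone A.pow := antitone_nat_of_succ_le A.pow_succ_le

theorem mul_mem_pow_left {n : ℕ} {a : A} (b : A) (h : a ∈ A.pow n) : a * b ∈ A.pow n :=
  A.pow_succ_le n (A.mul_mem_pow_succ b h)

theorem mul_mem_pow {m n : ℕ} {a b : A} (ha : a ∈ A.pow m) (hb : b ∈ A.pow n) :
    a * b ∈ A.pow (m + n) := by
  refine A.pow_induction (p := fun n b => a * b ∈ A.pow (m + n))
    (fun b => A.mul_mem_pow_left b ha) (fun b => A.mul_mem_pow_succ b ha)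
    (fun n b _ ih c => ?_) (fun n b c hb hc => ?_) (fun n c b hb => ?_) n b hb
  · rw [← mul_assoc]
    exact A.mul_mem_pow_succ c ih
  · rw [mul_add]
    exact add_mem hb hc
  · rw [mul_smul_comm]
    exact Submodule.smul_mem _ c hb

theorem sgn_mem_pow {n : ℕ} {a : A} (h : a ∈ A.pow n) : A.sgn a ∈ A.pow n := by
  refine A.pow_induction (p := fun n a => A.sgn a ∈ A.pow n) (fun _ => Submodule.mem_top) (fun _ => Submodule.mem_top)
    (fun n a _ ih b => ?_) (fun n a b ha hb => ?_) (fun n c a ha => ?_) n a h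
  · rw [sgn_mul]
    exact A.mul_mem_pow_succ _ ih
  · rw [map_add]
    exact add_mem ha hb
  · rw [map_smul]
    exact Submodule.smul_mem _ c ha

theorem d_mem_pow {n : ℕ} {a : A} (h : a ∈ A.pow n) : A.d a ∈ A.pow n := by
  refine A.pow_induction (p := fun n a => A.d a ∈ A.pow n) (fun _ => Submodule.mem_top) (fun _ => Submodule.mem_top)
    (fun n a ha ih b => ?_) (fun n a b ha hb => ?_) (fun n c a ha => ?_) n a h
  · rw [d_mul]
    exact add_mem (A.mul_mem_pow_succ _ ih) (A.mul_mem_pow_succ _ (A.sgn_mem_pow ha))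
  · rw [map_add]
    exact add_mem ha hb
  · rw [map_smul]
    exact Submodule.smul_mem _ c ha

theorem exists_sum_proj (a : A) : ∃ s : Finset ℤ, a = ∑ i ∈ s, A.proj i a := by
  refine ⟨(A.proj_finite a).toFinset, ?_⟩
  rw [← sub_eq_zero]
  refine A.eq_zero_of_proj fun i => ?_
  rw [map_sub, map_sum, sub_eq_zero]
  by_cases hi : A.proj i a = 0
  · rw [hi, Finset.sum_eq_zero]
    intro j _
    by_cases hji : j = i
    · rw [hji, hi, map_zero]
    · exact A.proj_ne (A.proj_mem j a) hji
  · rw [Finset.sum_eq_single i]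
    · exact (A.proj_same (A.proj_mem i a)).symm
    · intro j _ hji
      exact A.proj_ne (A.proj_mem j a) hji
    · intro h
      simp at h
      exact absurd h hi

theorem proj_mem_pow {n : ℕ} {a : A} (h : a ∈ A.pow n) : ∀ i, A.proj i a ∈ A.pow n := by
  refine A.pow_induction (p := fun n a => ∀ i, A.proj i a ∈ A.pow n) (fun _ _ => Submodule.mem_top)
    (fun _ _ => Submodule.mem_top) (fun n a _ ih b i => ?_) (fun n a b ha hb i => ?_)
    (fun n c a ha i => ?_) n a h
  · obtain ⟨s, hs⟩ := A.exists_sum_proj a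
    rw [hs, Finset.sum_mul, map_sum]
    refine Submodule.sum_mem _ fun j _ => ?_
    induction b using A.gr_induction with
    | h0 => simp
    | hadd x y hx hy => rw [mul_add, map_add]; exact add_mem hx hy
    | hgr k x hx =>
      have hm := A.mul_mem (A.proj_mem j a) hx
      by_cases hjk : j + k = i
      · subst hjk
        rw [A.proj_same hm]
        exact A.mul_mem_pow_succ _ (ih j)
      · rw [A.proj_ne hm hjk]
        exact zero_mem _
  · rw [map_add]
    exact add_mem (ha i) (hb i)
  · rw [map_smul]
    exact Submodule.smul_mem _ c (ha i)

end lemmas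

/-- The sub-dg-algebra given by a subalgebra which is graded and stable under `d`. -/
def sub (A : DGAlg K) (S : NonUnitalSubalgebra K A) (hproj : ∀ i, ∀ x ∈ S, A.proj i x ∈ S)
    (hd : ∀ x ∈ S, A.d x ∈ S) : DGAlg K where
  carrier := S
  gr := fun i =>
    { carrier := {x | (x : A) ∈ A.gr i}
      add_mem' := fun ha hb => add_mem (S := Submodule K A) ha hb
      zero_mem' := zero_mem (A.gr i)
      smul_mem' := fun c _ ha => Submodule.smul_mem (A.gr i) c ha }
  isInternal := isInternal_of_proj _
    (fun i =>
      { toFun := fun x => ⟨A.proj i x, hproj i x x.2⟩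
        map_add' := fun x y => Subtype.ext (map_add (A.proj i) (x : A) y)
        map_smul' := fun c x => Subtype.ext (map_smul (A.proj i) c (x : A)) })
    (fun i x => A.proj_mem i x)
    (fun i x hx => Subtype.ext (A.proj_same hx))
    (fun i j hij x hx => Subtype.ext (A.proj_ne hx hij))
    (fun x => (A.proj_finite x).subset fun i hi h => hi (Subtype.ext h))
    (fun x hx => Subtype.ext (A.eq_zero_of_proj fun i => congrArg Subtype.val (hx i)))
  mul_mem := fun ha hb => A.mul_mem ha hb
  comm := fun {i j a b} ha hb => by
    refine Subtype.ext ((A.comm ha hb).trans ?_)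
    simp only [Units.smul_def]
    rfl
  d :=
    { toFun := fun x => ⟨A.d x, hd x x.2⟩
      map_add' := fun x y => Subtype.ext (map_add A.d (x : A) y)
      map_smul' := fun c x => Subtype.ext (map_smul A.d c (x : A)) }
  d_mem := fun ha => A.d_mem ha
  d_d := fun a => Subtype.ext (A.d_d a)
  leibniz := fun {i a} b ha => by
    refine Subtype.ext ((A.leibniz (b : A) ha).trans ?_)
    simp only [Units.smul_def]
    rfl

/-- The inclusion of a sub-dg-algebra. -/
def subIncl (A : DGAlg K) (S : NonUnitalSubalgebra K A) (hproj : ∀ i, ∀ x ∈ S, A.proj i x ∈ S)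
    (hd : ∀ x ∈ S, A.d x ∈ S) : Hom (A.sub S hproj hd) A where
  toNonUnitalAlgHom := NonUnitalSubalgebraClass.subtype S
  map_gr := fun ha => ha
  map_d := fun _ => rfl

/-- The product `A × B`, with componentwise operations. -/
def prod (A B : DGAlg K) : DGAlg K where
  carrier := A × B
  gr := fun i => (A.gr i).prod (B.gr i)
  isInternal := isInternal_of_proj _ (fun i => (A.proj i).prodMap (B.proj i))
    (fun i x => ⟨A.proj_mem i x.1, B.proj_mem i x.2⟩)
    (fun i x hx => Prod.ext (A.proj_same hx.1) (B.proj_same hx.2))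
    (fun i j hij x hx => Prod.ext (A.proj_ne hx.1 hij) (B.proj_ne hx.2 hij))
    (fun x => ((A.proj_finite x.1).union (B.proj_finite x.2)).subset fun i hi => by
      by_contra h
      simp only [Set.mem_union, Set.mem_ofPred_eq, not_or, not_not] at h
      exact hi (Prod.ext h.1 h.2))
    (fun x hx => Prod.ext (A.eq_zero_of_proj fun i => congrArg Prod.fst (hx i))
      (B.eq_zero_of_proj fun i => congrArg Prod.snd (hx i)))
  mul_mem := fun ha hb => ⟨A.mul_mem ha.1 hb.1, B.mul_mem ha.2 hb.2⟩
  comm := fun ha hb => Prod.ext (A.comm ha.1 hb.1) (B.comm ha.2 hb.2)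
  d := A.d.prodMap B.d
  d_mem := fun ha => ⟨A.d_mem ha.1, B.d_mem ha.2⟩
  d_d := fun a => Prod.ext (A.d_d a.1) (B.d_d a.2)
  leibniz := fun b ha => Prod.ext (A.leibniz b.1 ha.1) (B.leibniz b.2 ha.2)

/-- The first projection of a product. -/
def prodFst (A B : DGAlg K) : Hom (A.prod B) A where
  toNonUnitalAlgHom := NonUnitalAlgHom.fst K A B
  map_gr := fun ha => ha.1
  map_d := fun _ => rfl

/-- The second projection of a product. -/
def prodSnd (A B : DGAlg K) : Hom (A.prod B) B where
  toNonUnitalAlgHom := NonUnitalAlgHom.snd K A B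
  map_gr := fun ha => ha.2
  map_d := fun _ => rfl

/-- The fibre product `A ×_C B = {(a, b) | α a = β b}` as a subalgebra of `A × B`. -/
def fiberSubalgebra {A B C : DGAlg K} (α : Hom A C) (β : Hom B C) :
    NonUnitalSubalgebra K (A.prod B) where
  carrier := {x | α (A.prodFst B x) = β (A.prodSnd B x)}
  add_mem' := fun {x y} hx hy => by
    simp only [Set.mem_ofPred_eq] at *
    simp only [map_add, hx, hy]
  zero_mem' := by simp only [Set.mem_ofPred_eq, map_zero]
  mul_mem' := fun {x y} hx hy => by
    simp only [Set.mem_ofPred_eq] at *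
    simp only [map_mul, hx, hy]
  smul_mem' := fun c x hx => by
    simp only [Set.mem_ofPred_eq] at *
    simp only [map_smul, hx]

theorem mem_fiberSubalgebra {A B C : DGAlg K} {α : Hom A C} {β : Hom B C} {x : A.prod B} :
    x ∈ fiberSubalgebra α β ↔ α (A.prodFst B x) = β (A.prodSnd B x) := Iff.rfl

/-- The fibre product `A ×_C B` of dg-algebras. -/
def fiber {A B C : DGAlg K} (α : Hom A C) (β : Hom B C) : DGAlg K :=
  (A.prod B).sub (fiberSubalgebra α β)
    (fun i x hx => by
      rw [mem_fiberSubalgebra] at *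
      rw [Hom.map_proj, Hom.map_proj, Hom.map_proj, Hom.map_proj, hx])
    (fun x hx => by
      rw [mem_fiberSubalgebra] at *
      rw [Hom.map_d, Hom.map_d, Hom.map_d, Hom.map_d, hx])

/-- The projection `A ×_C B → A`. -/
def fiberFst {A B C : DGAlg K} (α : Hom A C) (β : Hom B C) : Hom (fiber α β) A :=
  (subIncl _ _ _ _).comp (A.prodFst B)

/-- The projection `A ×_C B → B`. -/
def fiberSnd {A B C : DGAlg K} (α : Hom A C) (β : Hom B C) : Hom (fiber α β) B :=
  (subIncl _ _ _ _).comp (A.prodSnd B)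

/-- The zero algebra. -/
def zero (K : Type u) [Field K] : DGAlg K where
  carrier := PUnit.{u + 1}
  gr := fun _ => ⊤
  isInternal := isInternal_of_proj _ (fun _ => 0) (fun _ _ => Submodule.mem_top)
    (fun _ _ _ => rfl) (fun _ _ _ _ _ => rfl) (fun _ => by simp) (fun _ _ => rfl)
  mul_mem := fun _ _ => Submodule.mem_top
  comm := fun _ _ => rfl
  d := 0
  d_mem := fun _ => Submodule.mem_top
  d_d := fun _ => rfl
  leibniz := fun _ _ => rfl

/-! ### Polynomials and polynomial differential forms in one variable with coefficients in `A` -/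

section polynomials

variable (A : DGAlg K)

/-- Multiplication of polynomials `∑ a_n t ^ n` with coefficients `a_n` in `A`, written as
finitely supported functions `n ↦ a_n`. -/
def polyMul : (ℕ →₀ A) →ₗ[K] (ℕ →₀ A) →ₗ[K] (ℕ →₀ A) :=
  Finsupp.lsum K fun m => LinearMap.flip (Finsupp.lsum K fun n =>
    ((LinearMap.mul K A).compr₂ (Finsupp.lsingle (m + n))).flip)

/-- A linear map applied to the coefficients of a polynomial. -/
def polyMap (f : A →ₗ[K] A) : (ℕ →₀ A) →ₗ[K] (ℕ →₀ A) := Finsupp.mapRange.linearMap f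

/-- The formal derivative with respect to `t` of a polynomial. -/
def polyDeriv : (ℕ →₀ A) →ₗ[K] (ℕ →₀ A) :=
  Finsupp.lsum K fun n => (n : K) • Finsupp.lsingle (n - 1)

/-- The value at `t = s` of a polynomial. -/
def polyEval (s : K) : (ℕ →₀ A) →ₗ[K] A := Finsupp.lsum K fun n => s ^ n • LinearMap.id

@[simp]
theorem polyMul_single (m n : ℕ) (a b : A) :
    A.polyMul (Finsupp.single m a) (Finsupp.single n b) = Finsupp.single (m + n) (a * b) := by
  simp [polyMul]

@[simp]
theorem polyMap_single (f : A →ₗ[K] A) (n : ℕ) (a : A) :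
    A.polyMap f (Finsupp.single n a) = Finsupp.single n (f a) := by
  simp [polyMap]

@[simp]
theorem polyMap_apply (f : A →ₗ[K] A) (p : ℕ →₀ A) (n : ℕ) : A.polyMap f p n = f (p n) := by
  simp [polyMap]

@[simp]
theorem polyDeriv_single (n : ℕ) (a : A) :
    A.polyDeriv (Finsupp.single n a) = Finsupp.single (n - 1) ((n : K) • a) := by
  simp [polyDeriv]

theorem polyDeriv_apply (p : ℕ →₀ A) (n : ℕ) :
    A.polyDeriv p n = ((n + 1 : ℕ) : K) • p (n + 1) := by
  induction p using Finsupp.induction_linear with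
  | zero => simp
  | add p q hp hq => simp only [map_add, Finsupp.add_apply, smul_add, hp, hq]
  | single m a =>
    rw [polyDeriv_single]
    rcases m with _ | m
    · simp
    · by_cases h : m = n
      · subst h; simp
      · rw [Finsupp.single_eq_of_ne, Finsupp.single_eq_of_ne, smul_zero] <;> omega

@[simp]
theorem polyEval_single (s : K) (n : ℕ) (a : A) :
    A.polyEval s (Finsupp.single n a) = s ^ n • a := by
  simp [polyEval]

theorem polyMul_apply (p q : ℕ →₀ A) (n : ℕ) :
    A.polyMul p q n = ∑ x ∈ Finset.HasAntidiagonal.antidiagonal n, p x.1 * q x.2 := by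
  induction p using Finsupp.induction_linear with
  | zero => simp
  | add p p' hp hp' =>
    simp only [map_add, LinearMap.add_apply, Finsupp.add_apply, hp, hp', add_mul,
      Finset.sum_add_distrib]
  | single i a =>
    induction q using Finsupp.induction_linear with
    | zero => simp
    | add q q' hq hq' =>
      simp only [map_add, Finsupp.add_apply, hq, hq', mul_add, Finset.sum_add_distrib]
    | single j b =>
      rw [polyMul_single]
      by_cases h : i + j = n
      · rw [Finset.sum_eq_single (i, j)]
        · simp [h]
        · rintro ⟨k, l⟩ _ hkl
          by_cases hk : k = i
          · have hl : l ≠ j := fun hl => hkl (by rw [hk, hl])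
            simp [Finsupp.single_eq_of_ne hl]
          · simp [Finsupp.single_eq_of_ne hk]
        · intro h'
          simp [h] at h'
      · rw [Finsupp.single_eq_of_ne (Ne.symm h), Finset.sum_eq_zero]
        rintro ⟨k, l⟩ hkl
        rw [Finset.HasAntidiagonal.mem_antidiagonal] at hkl
        by_cases hk : k = i
        · have hl : l ≠ j := fun hl => h (by rw [← hk, ← hl]; exact hkl)
          simp [Finsupp.single_eq_of_ne hl]
        · simp [Finsupp.single_eq_of_ne hk]

theorem polyMul_assoc (p q r : ℕ →₀ A) :
    A.polyMul (A.polyMul p q) r = A.polyMul p (A.polyMul q r) := by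
  induction p using Finsupp.induction_linear with
  | zero => simp
  | add p p' hp hp' => simp only [map_add, LinearMap.add_apply, hp, hp']
  | single i a =>
    induction q using Finsupp.induction_linear with
    | zero => simp
    | add q q' hq hq' => simp only [map_add, LinearMap.add_apply, hq, hq']
    | single j b =>
      induction r using Finsupp.induction_linear with
      | zero => simp
      | add r r' hr hr' => simp only [map_add, hr, hr']
      | single k c => simp only [polyMul_single, add_assoc, mul_assoc]

theorem polyMap_polyMap (f g : A →ₗ[K] A) (p : ℕ →₀ A) :
    A.polyMap f (A.polyMap g p) = A.polyMap (f ∘ₗ g) p := by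
  ext n; simp

theorem polyMap_sgn_mul (p q : ℕ →₀ A) :
    A.polyMap A.sgn (A.polyMul p q) = A.polyMul (A.polyMap A.sgn p) (A.polyMap A.sgn q) := by
  ext n; simp [polyMul_apply, sgn_mul]

theorem polyMap_d_mul (p q : ℕ →₀ A) :
    A.polyMap A.d (A.polyMul p q) =
      A.polyMul (A.polyMap A.d p) q + A.polyMul (A.polyMap A.sgn p) (A.polyMap A.d q) := by
  ext n; simp [polyMul_apply, d_mul, Finset.sum_add_distrib]

theorem polyMap_sgn_d (p : ℕ →₀ A) :
    A.polyMap A.sgn (A.polyMap A.d p) = -A.polyMap A.d (A.polyMap A.sgn p) := by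
  ext n; simp [sgn_d]

theorem polyMap_d_d (p : ℕ →₀ A) : A.polyMap A.d (A.polyMap A.d p) = 0 := by
  ext n; simp [d_d]

theorem polyDeriv_polyMap (f : A →ₗ[K] A) (p : ℕ →₀ A) :
    A.polyDeriv (A.polyMap f p) = A.polyMap f (A.polyDeriv p) := by
  ext n; simp [polyDeriv_apply]

theorem polyDeriv_mul (p q : ℕ →₀ A) :
    A.polyDeriv (A.polyMul p q) =
      A.polyMul (A.polyDeriv p) q + A.polyMul p (A.polyDeriv q) := by
  induction p using Finsupp.induction_linear with
  | zero => simp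
  | add p p' hp hp' => simp only [map_add, LinearMap.add_apply, hp, hp']; abel
  | single i a =>
    induction q using Finsupp.induction_linear with
    | zero => simp
    | add q q' hq hq' => simp only [map_add, hq, hq']; abel
    | single j b =>
      simp only [polyMul_single, polyDeriv_single, smul_mul_assoc, mul_smul_comm]
      rcases i with _ | i
      · simp
      · rcases j with _ | j
        · simp
        · rw [show i + 1 - 1 + (j + 1) = i + 1 + (j + 1) - 1 by omega,
            show i + 1 + (j + 1 - 1) = i + 1 + (j + 1) - 1 by omega, ← Finsupp.single_add,
            ← add_smul]
          push_cast
          rfl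

theorem polyEval_mul (s : K) (p q : ℕ →₀ A) :
    A.polyEval s (A.polyMul p q) = A.polyEval s p * A.polyEval s q := by
  induction p using Finsupp.induction_linear with
  | zero => simp
  | add p p' hp hp' => simp only [map_add, LinearMap.add_apply, hp, hp', add_mul]
  | single i a =>
    induction q using Finsupp.induction_linear with
    | zero => simp
    | add q q' hq hq' => simp only [map_add, hq, hq', mul_add]
    | single j b =>
      simp only [polyMul_single, polyEval_single, smul_mul_assoc, mul_smul_comm, smul_smul, pow_add,
        mul_comm]

theorem polyEval_d (s : K) (p : ℕ →₀ A) :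
    A.polyEval s (A.polyMap A.d p) = A.d (A.polyEval s p) := by
  induction p using Finsupp.induction_linear with
  | zero => simp
  | add p p' hp hp' => simp only [map_add, hp, hp']
  | single i a => simp

theorem polyEval_mem {i : ℤ} (s : K) {p : ℕ →₀ A} (h : ∀ n, p n ∈ A.gr i) :
    A.polyEval s p ∈ A.gr i := by
  rw [polyEval, Finsupp.lsum_apply]
  exact Submodule.sum_mem _ fun n _ => Submodule.smul_mem _ _ (h n)

theorem polyMul_comm {i j : ℤ} {p q : ℕ →₀ A} (hp : ∀ n, p n ∈ A.gr i) (hq : ∀ n, q n ∈ A.gr j) :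
    A.polyMul p q = (i * j).negOnePow • A.polyMul q p := by
  ext n
  rw [Units.smul_def, Finsupp.smul_apply, polyMul_apply, polyMul_apply,
    ← Finset.Nat.sum_antidiagonal_swap, Finset.smul_sum]
  refine Finset.sum_congr rfl fun x _ => ?_
  rw [← Units.smul_def]
  exact A.comm (hp _) (hq _)

theorem polyMap_sgn_of_mem {i : ℤ} {p : ℕ →₀ A} (hp : ∀ n, p n ∈ A.gr i) :
    A.polyMap A.sgn p = i.negOnePow • p := by
  ext n
  rw [polyMap_apply, A.sgn_of_mem (hp n), Units.smul_def, Units.smul_def, Finsupp.smul_apply]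

theorem polyMul_mem {i j : ℤ} {p q : ℕ →₀ A} (hp : ∀ n, p n ∈ A.gr i) (hq : ∀ n, q n ∈ A.gr j)
    (n : ℕ) : A.polyMul p q n ∈ A.gr (i + j) := by
  rw [polyMul_apply]
  exact Submodule.sum_mem _ fun x _ => A.mul_mem (hp _) (hq _)

theorem polyProj_finite (p : ℕ →₀ A) : {i : ℤ | A.polyMap (A.proj i) p ≠ 0}.Finite := by
  refine (p.support.finite_toSet.biUnion fun n _ => A.proj_finite (p n)).subset fun i hi => ?_
  by_contra h
  refine hi (Finsupp.ext fun n => ?_)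
  rw [polyMap_apply, Finsupp.zero_apply]
  by_contra hn
  refine h (Set.mem_biUnion (x := n) ?_ hn)
  simp only [Finset.mem_coe, Finsupp.mem_support_iff]
  intro h0
  exact hn (by rw [h0, map_zero])

theorem eq_zero_of_polyProj {p : ℕ →₀ A} (h : ∀ i, A.polyMap (A.proj i) p = 0) : p = 0 :=
  Finsupp.ext fun n => A.eq_zero_of_proj fun i => by
    rw [← polyMap_apply, h i, Finsupp.zero_apply]

/-- The underlying space of `A[t, dt] = A ⊗ K[t, dt]`. The pair `(p, q)` stands for
`∑ p_n ⊗ t ^ n + ∑ q_n ⊗ t ^ n dt`. -/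
def Forms (A : DGAlg K) : Type u := (ℕ →₀ A) × (ℕ →₀ A)

namespace Forms

instance : AddCommGroup A.Forms := inferInstanceAs (AddCommGroup ((ℕ →₀ A) × (ℕ →₀ A)))

instance : Module K A.Forms := inferInstanceAs (Module K ((ℕ →₀ A) × (ℕ →₀ A)))

/-- The Koszul sign rule gives `(a ⊗ t ^ m dt) (b ⊗ t ^ n) = (-1) ^ deg b (a b) ⊗ t ^ (m + n) dt`. -/
instance : Mul A.Forms :=
  ⟨fun x y => (A.polyMul x.1 y.1, A.polyMul x.1 y.2 + A.polyMul x.2 (A.polyMap A.sgn y.1))⟩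

variable {A}

theorem ext {x y : A.Forms} (h₁ : x.1 = y.1) (h₂ : x.2 = y.2) : x = y := Prod.ext h₁ h₂

theorem add_fst (x y : A.Forms) : (x + y).1 = x.1 + y.1 := rfl
theorem add_snd (x y : A.Forms) : (x + y).2 = x.2 + y.2 := rfl
theorem zero_fst : (0 : A.Forms).1 = 0 := rfl
theorem zero_snd : (0 : A.Forms).2 = 0 := rfl
theorem smul_fst (c : K) (x : A.Forms) : (c • x).1 = c • x.1 := rfl
theorem smul_snd (c : K) (x : A.Forms) : (c • x).2 = c • x.2 := rfl
theorem zsmul_fst (c : ℤ) (x : A.Forms) : (c • x).1 = c • x.1 := rfl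
theorem zsmul_snd (c : ℤ) (x : A.Forms) : (c • x).2 = c • x.2 := rfl
theorem mul_fst (x y : A.Forms) : (x * y).1 = A.polyMul x.1 y.1 := rfl
theorem mul_snd (x y : A.Forms) :
    (x * y).2 = A.polyMul x.1 y.2 + A.polyMul x.2 (A.polyMap A.sgn y.1) := rfl

instance : NonUnitalRing A.Forms where
  left_distrib := fun x y z => by
    apply ext
    · simp only [mul_fst, add_fst, map_add]
    · simp only [mul_snd, add_fst, add_snd, map_add]; abel
  right_distrib := fun x y z => by
    apply ext
    · simp only [mul_fst, add_fst, map_add, LinearMap.add_apply]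
    · simp only [mul_snd, add_fst, add_snd, map_add, LinearMap.add_apply]; abel
  zero_mul := fun x => by
    apply ext
    · simp only [mul_fst, zero_fst, map_zero, LinearMap.zero_apply]
    · simp only [mul_snd, zero_fst, zero_snd, map_zero, LinearMap.zero_apply, add_zero]
  mul_zero := fun x => by
    apply ext
    · simp only [mul_fst, zero_fst, map_zero]
    · simp only [mul_snd, zero_fst, zero_snd, map_zero, add_zero]
  mul_assoc := fun x y z => by
    apply ext
    · simp only [mul_fst, polyMul_assoc]
    · simp only [mul_fst, mul_snd, map_add, LinearMap.add_apply, polyMul_assoc, polyMap_sgn_mul,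
        add_assoc]

instance : IsScalarTower K A.Forms A.Forms where
  smul_assoc := fun c x y => by
    apply ext
    · simp only [smul_eq_mul, mul_fst, smul_fst, map_smul, LinearMap.smul_apply]
    · simp only [smul_eq_mul, mul_snd, smul_fst, smul_snd, map_smul, LinearMap.smul_apply, smul_add]

instance : SMulCommClass K A.Forms A.Forms where
  smul_comm := fun c x y => by
    apply ext
    · simp only [smul_eq_mul, mul_fst, smul_fst, map_smul]
    · simp only [smul_eq_mul, mul_snd, smul_fst, smul_snd, map_smul, smul_add]

end Forms

/-- The projection of `A[t, dt]` onto its component of degree `i`. -/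
def Forms.proj (i : ℤ) : A.Forms →ₗ[K] A.Forms :=
  (A.polyMap (A.proj i)).prodMap (A.polyMap (A.proj (i - 1)))

theorem Forms.proj_fst (i : ℤ) (x : A.Forms) :
    (Forms.proj A i x).1 = A.polyMap (A.proj i) x.1 := rfl

theorem Forms.proj_snd (i : ℤ) (x : A.Forms) :
    (Forms.proj A i x).2 = A.polyMap (A.proj (i - 1)) x.2 := rfl

/-- The differential of `A[t, dt]`, given by
`d (a ⊗ t ^ n) = d a ⊗ t ^ n + (-1) ^ deg a (n a) ⊗ t ^ (n - 1) dt` and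
`d (a ⊗ t ^ n dt) = d a ⊗ t ^ n dt`. -/
def Forms.d : A.Forms →ₗ[K] A.Forms where
  toFun := fun x => (A.polyMap A.d x.1, A.polyMap A.d x.2 + A.polyMap A.sgn (A.polyDeriv x.1))
  map_add' := fun x y => by
    refine Forms.ext (map_add _ x.1 y.1) (Eq.trans ?_ (add_add_add_comm _ _ _ _))
    simp only [Forms.add_fst, Forms.add_snd, map_add]
  map_smul' := fun c x => by
    refine Forms.ext (map_smul _ c x.1) (Eq.trans ?_ (smul_add _ _ _).symm)
    simp only [Forms.smul_fst, Forms.smul_snd, map_smul, RingHom.id_apply]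

theorem Forms.d_fst (x : A.Forms) : (Forms.d A x).1 = A.polyMap A.d x.1 := rfl

theorem Forms.d_snd (x : A.Forms) :
    (Forms.d A x).2 = A.polyMap A.d x.2 + A.polyMap A.sgn (A.polyDeriv x.1) := rfl

/-- The dg-algebra `A[t, dt] = A ⊗ K[t, dt]`, where `t` has degree `0` and `dt` has degree `1`. -/
def forms : DGAlg K where
  carrier := A.Forms
  gr := fun i =>
    { carrier := {x | (∀ n, x.1 n ∈ A.gr i) ∧ ∀ n, x.2 n ∈ A.gr (i - 1)}
      add_mem' := fun ha hb => ⟨fun n => add_mem (ha.1 n) (hb.1 n), fun n => add_mem (ha.2 n) (hb.2 n)⟩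
      zero_mem' := ⟨fun _ => zero_mem _, fun _ => zero_mem _⟩
      smul_mem' := fun c _ ha =>
        ⟨fun n => Submodule.smul_mem _ c (ha.1 n), fun n => Submodule.smul_mem _ c (ha.2 n)⟩ }
  isInternal := isInternal_of_proj _ (Forms.proj A)
    (fun i x => ⟨fun n => by rw [Forms.proj_fst, polyMap_apply]; exact A.proj_mem _ _,
      fun n => by rw [Forms.proj_snd, polyMap_apply]; exact A.proj_mem _ _⟩)
    (fun i x hx => Forms.ext
      (Finsupp.ext fun n => by rw [Forms.proj_fst, polyMap_apply, A.proj_same (hx.1 n)])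
      (Finsupp.ext fun n => by rw [Forms.proj_snd, polyMap_apply, A.proj_same (hx.2 n)]))
    (fun i j hij x hx => Forms.ext
      (Finsupp.ext fun n => by
        rw [Forms.proj_fst, polyMap_apply, A.proj_ne (hx.1 n) hij]; rfl)
      (Finsupp.ext fun n => by
        rw [Forms.proj_snd, polyMap_apply, A.proj_ne (hx.2 n) (by omega)]; rfl))
    (fun x => by
      refine ((A.polyProj_finite x.1).union
        ((A.polyProj_finite x.2).preimage (f := fun i => i - 1)
          (fun _ _ _ _ h => by simpa using h))).subset fun i hi => ?_
      by_contra h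
      simp only [Set.mem_union, Set.mem_preimage, Set.mem_ofPred_eq, not_or, not_not] at h
      exact hi (Forms.ext h.1 h.2))
    (fun x hx => Forms.ext (A.eq_zero_of_polyProj fun i => congrArg Prod.fst (hx i))
      (A.eq_zero_of_polyProj fun i => by
        have := congrArg Prod.snd (hx (i + 1))
        rwa [Forms.proj_snd, add_sub_cancel_right] at this))
  mul_mem := fun {i j a b} ha hb => by
    refine ⟨A.polyMul_mem ha.1 hb.1, fun n => ?_⟩
    rw [Forms.mul_snd]
    refine add_mem ?_ ?_
    · have := A.polyMul_mem ha.1 hb.2 n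
      rwa [show i + (j - 1) = i + j - 1 by ring] at this
    · have := A.polyMul_mem (p := a.2) (q := A.polyMap A.sgn b.1) ha.2
        (fun n => by simpa using A.sgn_mem (hb.1 n)) n
      rwa [show i - 1 + j = i + j - 1 by ring] at this
  comm := fun {i j a b} ha hb => by
    apply Forms.ext
    · exact A.polyMul_comm ha.1 hb.1
    · rw [Units.smul_def, Forms.zsmul_snd, Forms.mul_snd, Forms.mul_snd,
        A.polyMap_sgn_of_mem ha.1, A.polyMap_sgn_of_mem hb.1, A.polyMul_comm ha.1 hb.2]
      simp only [Units.smul_def, map_zsmul]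
      rw [A.polyMul_comm ha.2 hb.1, Units.smul_def, smul_smul, smul_add, smul_smul,
        ← Units.val_mul, ← Units.val_mul, ← Int.negOnePow_add, ← Int.negOnePow_add, add_comm]
      congr 2
      · congr 1
        rw [Int.negOnePow_eq_iff]
        exact ⟨0, by ring⟩
      · congr 1
        rw [Int.negOnePow_eq_iff]
        exact ⟨-i, by ring⟩
  d := Forms.d A
  d_mem := fun {i a} ha => by
    refine ⟨fun n => by rw [Forms.d_fst, polyMap_apply]; exact A.d_mem (ha.1 n), fun n => ?_⟩
    rw [Forms.d_snd, Finsupp.add_apply, polyMap_apply, polyMap_apply, polyDeriv_apply]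
    refine add_mem ?_ ?_
    · have := A.d_mem (ha.2 n)
      rwa [show i - 1 + 1 = i + 1 - 1 by ring] at this
    · rw [show i + 1 - 1 = i by ring]
      exact A.sgn_mem (Submodule.smul_mem _ _ (ha.1 _))
  d_d := fun a => by
    apply Forms.ext
    · exact A.polyMap_d_d a.1
    · simp only [Forms.d_fst, Forms.d_snd, map_add, polyMap_d_d, polyDeriv_polyMap,
        polyMap_sgn_d, zero_add, add_neg_cancel, Forms.zero_snd]
  leibniz := fun {i a} b ha => by
    have h1 : i.negOnePow • A.polyMap A.sgn a.1 = a.1 := by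
      rw [A.polyMap_sgn_of_mem ha.1, smul_smul, Int.units_mul_self, one_smul]
    have h2 : A.polyMap A.sgn a.2 = -(i.negOnePow • a.2) := by
      rw [A.polyMap_sgn_of_mem ha.2, Int.negOnePow_sub, Int.negOnePow_one, mul_neg, mul_one,
        Units.neg_smul]
    have h3 := A.polyMap_sgn_of_mem ha.1
    rw [Units.smul_def] at *
    apply Forms.ext
    · simp only [Forms.d_fst, Forms.mul_fst, Forms.add_fst, Forms.zsmul_fst,
        polyMap_d_mul, h3, map_zsmul, LinearMap.smul_apply]
    · simp only [Forms.d_fst, Forms.d_snd, Forms.mul_fst, Forms.mul_snd,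
        Forms.add_snd, Forms.zsmul_snd, map_add, polyMap_d_mul, polyDeriv_mul, polyMap_sgn_mul,
        LinearMap.add_apply, h2, h3, map_neg, LinearMap.neg_apply, map_zsmul, LinearMap.smul_apply,
        polyMap_sgn_d, smul_add, smul_neg]
      abel

/-- The function part `∑ p_n ⊗ t ^ n` of an element of `A[t, dt]`, as the sequence `n ↦ p_n`. -/
def formsFst : A.forms →ₗ[K] (ℕ →₀ A) := LinearMap.fst K (ℕ →₀ A) (ℕ →₀ A)

/-- The form part `∑ q_n ⊗ t ^ n dt` of an element of `A[t, dt]`, as the sequence `n ↦ q_n`. -/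
def formsSnd : A.forms →ₗ[K] (ℕ →₀ A) := LinearMap.snd K (ℕ →₀ A) (ℕ →₀ A)

/-- The evaluation morphism `e_s : A[t, dt] → A`, `t ↦ s`, `dt ↦ 0`. -/
def formsEval (s : K) : Hom A.forms A where
  toFun := fun x => A.polyEval s (A.formsFst x)
  map_smul' := fun c x => map_smul (A.polyEval s) c x.1
  map_zero' := map_zero (A.polyEval s)
  map_add' := fun x y => map_add (A.polyEval s) x.1 y.1
  map_mul' := fun x y => A.polyEval_mul s x.1 y.1
  map_gr := fun ha => A.polyEval_mem s ha.1
  map_d := fun a => A.polyEval_d s a.1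

end polynomials

/-! ### The subalgebra `A[t, dt]_ε` -/

section path

variable (A : DGAlg K)

theorem Hom.map_pow {A B : DGAlg K} (f : Hom A B) {n : ℕ} {a : A} (h : a ∈ A.pow n) :
    f a ∈ B.pow n := by
  refine A.pow_induction (p := fun n a => f a ∈ B.pow n) (fun _ => Submodule.mem_top)
    (fun _ => Submodule.mem_top) (fun n a _ ih b => ?_) (fun n a b ha hb => ?_)
    (fun n c a ha => ?_) n a h
  · rw [map_mul]
    exact B.mul_mem_pow_succ _ ih
  · rw [map_add]
    exact add_mem ha hb
  · rw [map_smul]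
    exact Submodule.smul_mem _ c ha

theorem polyMul_mem_pow {p q : ℕ →₀ A} {k l m : ℕ → ℕ} (hp : ∀ i, p i ∈ A.pow (k i))
    (hq : ∀ i, q i ∈ A.pow (l i)) (h : ∀ i j, m (i + j) ≤ k i + l j) (n : ℕ) :
    A.polyMul p q n ∈ A.pow (m n) := by
  rw [polyMul_apply]
  refine Submodule.sum_mem _ fun x hx => ?_
  rw [Finset.HasAntidiagonal.mem_antidiagonal] at hx
  rw [← hx]
  exact A.pow_antitone (h _ _) (A.mul_mem_pow (hp _) (hq _))

theorem forms_pow {n : ℕ} {x : A.forms} (h : x ∈ A.forms.pow n) :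
    (∀ i, A.formsFst x i ∈ A.pow n) ∧ ∀ i, A.formsSnd x i ∈ A.pow n := by
  refine A.forms.pow_induction
    (p := fun n x => (∀ i, A.formsFst x i ∈ A.pow n) ∧
      ∀ i, A.formsSnd x i ∈ A.pow n)
    (fun _ => ⟨fun _ => Submodule.mem_top, fun _ => Submodule.mem_top⟩)
    (fun _ => ⟨fun _ => Submodule.mem_top, fun _ => Submodule.mem_top⟩)
    (fun n a _ ih b => ?_)
    (fun n a b ha hb => ⟨fun i => add_mem (ha.1 i) (hb.1 i), fun i => add_mem (ha.2 i) (hb.2 i)⟩)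
    (fun n c a ha =>
      ⟨fun i => Submodule.smul_mem _ c (ha.1 i), fun i => Submodule.smul_mem _ c (ha.2 i)⟩) n x h
  have key : ∀ p q : ℕ →₀ A, (∀ i, p i ∈ A.pow (n + 1)) → ∀ i,
      A.polyMul p q i ∈ A.pow (n + 2) := by
    intro p q hp i
    rw [polyMul_apply]
    exact Submodule.sum_mem _ fun x _ => A.mul_mem_pow_succ _ (hp _)
  exact ⟨key _ _ ih.1, fun i => add_mem (key _ _ ih.1 i) (key _ _ ih.2 i)⟩

/-- The subalgebra
`A[t, dt]_ε = A ⊕ ⨁_{n > 0} A ^ ⌈n ε⌉ ⊗ (K t ^ n ⊕ K t ^ (n - 1) dt)` of `A[t, dt]`; for the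
coefficient of `t ^ 0` there is no condition, as `A ^ 0` denotes `A`. -/
def pathSubalgebra (ε : ℝ) : NonUnitalSubalgebra K A.forms where
  carrier := {x | (∀ n : ℕ, A.formsFst x n ∈ A.pow ⌈(n : ℝ) * ε⌉₊) ∧
    ∀ n : ℕ, A.formsSnd x n ∈ A.pow ⌈((n + 1 : ℕ) : ℝ) * ε⌉₊}
  add_mem' := fun ha hb =>
    ⟨fun n => add_mem (ha.1 n) (hb.1 n), fun n => add_mem (ha.2 n) (hb.2 n)⟩
  zero_mem' := ⟨fun _ => zero_mem _, fun _ => zero_mem _⟩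
  smul_mem' := fun c _ ha =>
    ⟨fun n => Submodule.smul_mem _ c (ha.1 n), fun n => Submodule.smul_mem _ c (ha.2 n)⟩
  mul_mem' := fun {a b} ha hb => by
    refine ⟨?_, fun n => add_mem ?_ ?_⟩
    · refine A.polyMul_mem_pow (m := fun n => ⌈(n : ℝ) * ε⌉₊) ha.1 hb.1 fun i j => ?_
      push_cast
      rw [add_mul]
      exact Nat.ceil_add_le _ _
    · refine A.polyMul_mem_pow (m := fun n => ⌈((n + 1 : ℕ) : ℝ) * ε⌉₊) ha.1 hb.2 (fun i j => ?_) n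
      rw [add_assoc, Nat.cast_add, add_mul]
      exact Nat.ceil_add_le _ _
    · refine A.polyMul_mem_pow (m := fun n => ⌈((n + 1 : ℕ) : ℝ) * ε⌉₊)
        (l := fun n => ⌈(n : ℝ) * ε⌉₊) ha.2 (fun i => ?_) (fun i j => ?_) n
      · rw [polyMap_apply]
        exact A.sgn_mem_pow (hb.1 i)
      · rw [add_right_comm, Nat.cast_add, add_mul]
        exact Nat.ceil_add_le _ _

theorem forms_proj (i : ℤ) (x : A.forms) : A.forms.proj i x = Forms.proj A i x := by
  induction x using A.forms.gr_induction with
  | h0 => rw [map_zero]; exact (map_zero (Forms.proj A i)).symm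
  | hadd x y hx hy => rw [map_add, hx, hy]; exact (map_add (Forms.proj A i) x y).symm
  | hgr j x hx =>
    by_cases h : j = i
    · subst h
      rw [A.forms.proj_same hx]
      exact Forms.ext
        (Finsupp.ext fun n => ((A.polyMap_apply _ _ n).trans (A.proj_same (hx.1 n))).symm)
        (Finsupp.ext fun n => ((A.polyMap_apply _ _ n).trans (A.proj_same (hx.2 n))).symm)
    · rw [A.forms.proj_ne hx h]
      exact Forms.ext
        (Finsupp.ext fun n => ((A.polyMap_apply _ _ n).trans (A.proj_ne (hx.1 n) h)).symm)
        (Finsupp.ext fun n =>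
          ((A.polyMap_apply _ _ n).trans (A.proj_ne (hx.2 n) (by omega))).symm)

/-- The dg-algebra `A[t, dt]_ε`. -/
def path (ε : ℝ) : DGAlg K :=
  A.forms.sub (A.pathSubalgebra ε)
    (fun i x hx => by
      rw [forms_proj]
      exact ⟨fun n => A.proj_mem_pow (hx.1 n) i, fun n => A.proj_mem_pow (hx.2 n) (i - 1)⟩)
    (fun x hx => by
      refine ⟨fun n => A.d_mem_pow (hx.1 n), fun n => add_mem (A.d_mem_pow (hx.2 n)) ?_⟩
      rw [polyMap_apply, polyDeriv_apply]
      exact A.sgn_mem_pow (Submodule.smul_mem _ _ (hx.1 (n + 1))))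

/-- The evaluation morphism `e_s : A[t, dt]_ε → A`, `t ↦ s`, `dt ↦ 0`. -/
def pathEval (ε : ℝ) (s : K) : Hom (A.path ε) A := (subIncl _ _ _ _).comp (A.formsEval s)

theorem sub_pow_eq_bot (S : NonUnitalSubalgebra K A) (hproj : ∀ i, ∀ x ∈ S, A.proj i x ∈ S)
    (hd : ∀ x ∈ S, A.d x ∈ S) {n : ℕ} (h : A.pow n = ⊥) : (A.sub S hproj hd).pow n = ⊥ := by
  rw [eq_bot_iff]
  intro x hx
  have := (A.subIncl S hproj hd).map_pow hx
  rw [h, Submodule.mem_bot] at this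
  exact Subtype.ext this

theorem sub_finite (S : NonUnitalSubalgebra K A) (hproj : ∀ i, ∀ x ∈ S, A.proj i x ∈ S)
    (hd : ∀ x ∈ S, A.d x ∈ S) [Module.Finite K A] : Module.Finite K (A.sub S hproj hd) :=
  Module.Finite.of_injective ((A.subIncl S hproj hd).toNonUnitalAlgHom : A.sub S hproj hd →ₗ[K] A)
    (fun _ _ h => Subtype.ext h)

theorem path_finite {ε : ℝ} (hε : 0 < ε) [Module.Finite K A] {N : ℕ} (hN : A.pow N = ⊥) :
    Module.Finite K (A.path ε) := by
  obtain ⟨M, hM⟩ := exists_nat_ge ((N : ℝ) / ε)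
  rw [div_le_iff₀ hε] at hM
  have key : ∀ n : ℕ, M ≤ n → ∀ a ∈ A.pow ⌈(n : ℝ) * ε⌉₊, a = 0 := by
    intro n hn a ha
    have h1 : N ≤ ⌈(n : ℝ) * ε⌉₊ := by
      have h2 : (N : ℝ) ≤ (n : ℝ) * ε :=
        hM.trans (mul_le_mul_of_nonneg_right (Nat.cast_le.mpr hn) hε.le)
      exact_mod_cast h2.trans (Nat.le_ceil _)
    have h3 := A.pow_antitone h1 ha
    rwa [hN, Submodule.mem_bot] at h3
  let f : A.path ε →ₗ[K] (Fin M → A) × (Fin M → A) :=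
    { toFun := fun x => (fun i => A.formsFst x.1 i, fun i => A.formsSnd x.1 i)
      map_add' := fun _ _ => rfl
      map_smul' := fun _ _ => rfl }
  refine Module.Finite.of_injective f ?_
  rw [injective_iff_map_eq_zero]
  intro x hx
  have hx1 := fun i => congrFun (congrArg Prod.fst hx) i
  have hx2 := fun i => congrFun (congrArg Prod.snd hx) i
  refine Subtype.ext (Forms.ext (Finsupp.ext fun n => ?_) (Finsupp.ext fun n => ?_))
  · by_cases hn : n < M
    · exact hx1 ⟨n, hn⟩
    · exact key n (not_lt.mp hn) _ (x.2.1 n)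
  · by_cases hn : n < M
    · exact hx2 ⟨n, hn⟩
    · exact key (n + 1) ((not_lt.mp hn).trans (Nat.le_succ n)) _ (x.2.2 n)

theorem path_pow_eq_bot (ε : ℝ) {n : ℕ} (h : A.pow n = ⊥) : (A.path ε).pow n = ⊥ := by
  refine sub_pow_eq_bot _ _ _ _ ?_
  rw [eq_bot_iff]
  intro x hx
  have hx' := A.forms_pow hx
  simp only [h, Submodule.mem_bot] at hx'
  exact Forms.ext (Finsupp.ext hx'.1) (Finsupp.ext hx'.2)

theorem fiber_pow_eq_bot {A B C : DGAlg K} (α : Hom A C) (β : Hom B C) {m n : ℕ}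
    (hA : A.pow m = ⊥) (hB : B.pow n = ⊥) : (fiber α β).pow (max m n) = ⊥ := by
  refine sub_pow_eq_bot _ _ _ _ ?_
  rw [eq_bot_iff]
  intro x hx
  have h1 := A.pow_antitone (le_max_left m n) ((A.prodFst B).map_pow hx)
  have h2 := B.pow_antitone (le_max_right m n) ((A.prodSnd B).map_pow hx)
  rw [hA, Submodule.mem_bot] at h1
  rw [hB, Submodule.mem_bot] at h2
  exact Prod.ext h1 h2

theorem fiber_finite {A B C : DGAlg K} (α : Hom A C) (β : Hom B C) [Module.Finite K A]
    [Module.Finite K B] : Module.Finite K (fiber α β) := by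
  have : Module.Finite K (A.prod B) := inferInstanceAs (Module.Finite K (A.carrier × B.carrier))
  exact sub_finite _ _ _ _

end path

end DGAlg

/-- The category of nilpotent differential graded algebras of finite dimension over `K`. -/
structure NilDGA (K : Type u) [Field K] : Type (u + 1) extends DGAlg K where
  finite : Module.Finite K carrier
  nilpotent : ∃ n, toDGAlg.pow n = ⊥

namespace NilDGA

variable {K : Type u} [Field K]

instance : Category (NilDGA K) where
  Hom A B := DGAlg.Hom A.toDGAlg B.toDGAlg
  id A := DGAlg.Hom.id A.toDGAlg
  comp f g := DGAlg.Hom.comp f g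

instance (A B : NilDGA K) : CoeFun (A ⟶ B) (fun _ => A.carrier → B.carrier) :=
  ⟨fun f => DGAlg.Hom.toNonUnitalAlgHom f⟩

/-- The zero algebra. -/
def zero (K : Type u) [Field K] : NilDGA K where
  toDGAlg := DGAlg.zero K
  finite := inferInstanceAs (Module.Finite K PUnit.{u + 1})
  nilpotent := ⟨0, Submodule.eq_bot_of_subsingleton (M := PUnit.{u + 1})⟩

/-- The fibre product `A ×_C B`. -/
def fiber {A B C : NilDGA K} (α : A ⟶ C) (β : B ⟶ C) : NilDGA K where
  toDGAlg := DGAlg.fiber α β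
  finite := by
    have := A.finite
    have := B.finite
    exact DGAlg.fiber_finite α β
  nilpotent := by
    obtain ⟨m, hm⟩ := A.nilpotent
    obtain ⟨n, hn⟩ := B.nilpotent
    exact ⟨max m n, DGAlg.fiber_pow_eq_bot α β hm hn⟩

/-- The projection `A ×_C B ⟶ A`. -/
def fiberFst {A B C : NilDGA K} (α : A ⟶ C) (β : B ⟶ C) : fiber α β ⟶ A := DGAlg.fiberFst α β

/-- The projection `A ×_C B ⟶ B`. -/
def fiberSnd {A B C : NilDGA K} (α : A ⟶ C) (β : B ⟶ C) : fiber α β ⟶ B := DGAlg.fiberSnd α β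

theorem fiber_condition {A B C : NilDGA K} (α : A ⟶ C) (β : B ⟶ C) :
    fiberFst α β ≫ α = fiberSnd α β ≫ β :=
  DGAlg.Hom.ext (funext fun x => x.2)

/-- The algebra `A[t, dt]_ε`, for `ε > 0`. -/
def path (A : NilDGA K) (ε : ℝ) (hε : 0 < ε) : NilDGA K where
  toDGAlg := A.toDGAlg.path ε
  finite := by
    have := A.finite
    obtain ⟨n, hn⟩ := A.nilpotent
    exact A.toDGAlg.path_finite hε hn
  nilpotent := by
    obtain ⟨n, hn⟩ := A.nilpotent
    exact ⟨n, A.toDGAlg.path_pow_eq_bot ε hn⟩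

/-- The evaluation `e_s : A[t, dt]_ε ⟶ A` at `t = s`, `dt = 0`. -/
def pathEval (A : NilDGA K) (ε : ℝ) (hε : 0 < ε) (s : K) : A.path ε hε ⟶ A :=
  A.toDGAlg.pathEval ε s

/-- `A` is an acyclic complex with trivial multiplication. -/
def IsAcyclicComplex (A : NilDGA K) : Prop :=
  (∀ a b : A.carrier, a * b = 0) ∧ ∀ a : A.carrier, A.d a = 0 → ∃ b, A.d b = a

/-- `p : A ⟶ B` is an acyclic small extension: it is surjective, and its kernel `I` satisfies
`A I = 0` and is an acyclic complex. -/
structure IsAcyclicSmallExtension {A B : NilDGA K} (p : A ⟶ B) : Prop where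
  surjective : Function.Surjective p
  small : ∀ a x : A.carrier, p x = 0 → a * x = 0
  acyclic : ∀ x : A.carrier, p x = 0 → A.d x = 0 → ∃ y : A.carrier, p y = 0 ∧ A.d y = x

/-- The canonical map `F (A ×_C B) → F A ×_{F C} F B`. -/
def fiberMap (F : NilDGA K ⥤ Type w) {A B C : NilDGA K} (α : A ⟶ C) (β : B ⟶ C)
    (x : F.obj (fiber α β)) : {y : F.obj A × F.obj B // F.map α y.1 = F.map β y.2} :=
  ⟨(F.map (fiberFst α β) x, F.map (fiberSnd α β) x), by
    rw [← Functor.map_comp_apply, ← Functor.map_comp_apply, fiber_condition]⟩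

/-- Predeformation functors. -/
structure IsPredeformation (F : NilDGA K ⥤ Type w) : Prop where
  zero : Nonempty (Unique (F.obj (zero K)))
  fiber_surjective : ∀ {A B C : NilDGA K} (α : A ⟶ C) (β : B ⟶ C),
    Function.Surjective α → Function.Surjective (fiberMap F α β)
  fiber_bijective : ∀ {A B C : NilDGA K} (α : A ⟶ C) (β : B ⟶ C),
    Function.Surjective α → C.IsAcyclicComplex → Function.Bijective (fiberMap F α β)
  quasismooth : ∀ {A B : NilDGA K} (p : A ⟶ B),
    IsAcyclicSmallExtension p → Function.Surjective (F.map p)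

/-- Deformation functors. -/
structure IsDeformation (F : NilDGA K ⥤ Type w) : Prop extends IsPredeformation F where
  bijective : ∀ {A B : NilDGA K} (p : A ⟶ B),
    IsAcyclicSmallExtension p → Function.Bijective (F.map p)

/-- Two elements `a, b` of `F A` are related by a homotopy if there are `ε > 0` and
`x ∈ F (A[t, dt]_ε)` with `e_0 x = a` and `e_1 x = b`. -/
def Homotopic (F : NilDGA K ⥤ Type w) (A : NilDGA K) (a b : F.obj A) : Prop :=
  ∃ (ε : ℝ) (hε : 0 < ε) (x : F.obj (A.path ε hε)),
    F.map (A.pathEval ε hε 0) x = a ∧ F.map (A.pathEval ε hε 1) x = b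

end NilDGA

end

/-! The functor `F⁺` sends `A` to the quotient of `F(A)` by homotopy (`homotopyQuot`), so the
description of `η` holds by construction. What needs proof is that this quotient is a deformation
functor and that it is universal. The tool is a supply of surjections that are compositions of
acyclic small extensions (`IsAcyclicTower`): predeformation functors are surjective on them, and
deformation functors bijective. `IsAcyclicTower.of_filtration` recognises such a surjection from a
finite filtration of its kernel by acyclic ideals `I k` with `A (I k) ⊆ I (k + 1)`. For path
algebras the filtration is by coefficients in the powers `A ^ k`, which vanish eventually, and
acyclicity is integration in `t`, available in characteristic zero (`exists_d_eq_of_eval_eq_zero`).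

Universality: the evaluation `e_0` is such a tower and the constants are a section of it, so a
deformation functor `G` makes the constants inverse to `G(e_0)`. They are also a section of `e_1`,
whence `G(e_0) = G(e_1)`: homotopic elements of `G` coincide (`IsDeformation.eq_of_homotopic`), and
every map `F → G` descends to the quotient.

Injectivity of `F⁺` on an acyclic small extension `p : A → B`: homotopies lift along every
surjection, because `A[t, dt]_ε → C[t, dt]_ε ×_C A` is a tower; this reduces to two elements of
`F(A)` with the same image. These are homotopic, because the paths in `A` with constant image in `B`
form an acyclic small extension of `A ×_B A` (`homotopic_of_map_eq`). Lifting homotopies also gives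
the surjectivity of `F⁺` on fibre products.

Injectivity of `F⁺` on `A ×_C B`, for `C` acyclic with zero multiplication: the inclusion in `A × B`
factors through the algebra of pairs `(w, b)` with `α (w(0)) = β b`. The second factor `(w, b) ↦
(w(1), b)` is a tower, so `F⁺` is injective on it; the first has the retraction `(w, b) ↦ (w(0),
b)`. -/

noncomputable section

/-! ### Quotients by differential graded ideals -/

namespace DGAlg

variable {K : Type u} [Field K]

/-- A surjective morphism maps `A ^ n` onto `B ^ n`. -/
theorem Hom.exists_mem_pow {A B : DGAlg K} (f : Hom A B) (hf : Function.Surjective f) {n : ℕ}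
    {b : B} (h : b ∈ B.pow n) : ∃ a ∈ A.pow n, f a = b := by
  refine B.pow_induction (p := fun n b => ∃ a ∈ A.pow n, f a = b) (fun b => ?_) (fun b => ?_)
    (fun n b _ ih c => ?_) (fun n b c hb hc => ?_) (fun n c b hb => ?_) n b h
  · obtain ⟨a, rfl⟩ := hf b
    exact ⟨a, Submodule.mem_top, rfl⟩
  · obtain ⟨a, rfl⟩ := hf b
    exact ⟨a, Submodule.mem_top, rfl⟩
  · obtain ⟨a, ha, rfl⟩ := ih
    obtain ⟨a', rfl⟩ := hf c
    exact ⟨a * a', A.mul_mem_pow_succ a' ha, map_mul _ _ _⟩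
  · obtain ⟨a, ha, rfl⟩ := hb
    obtain ⟨a', ha', rfl⟩ := hc
    exact ⟨a + a', add_mem ha ha', map_add _ _ _⟩
  · obtain ⟨a, ha, rfl⟩ := hb
    exact ⟨c • a, Submodule.smul_mem _ c ha, map_smul _ _ _⟩

theorem Hom.map_sgn {A B : DGAlg K} (f : Hom A B) (a : A) : f (A.sgn a) = B.sgn (f a) := by
  induction a using A.gr_induction with
  | h0 => simp
  | hadd x y hx hy => simp [hx, hy]
  | hgr i x hx =>
    rw [A.sgn_of_mem hx, B.sgn_of_mem (f.map_gr hx), Units.smul_def, Units.smul_def, map_zsmul]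

/-- A differential graded ideal. -/
structure IsDGIdeal (A : DGAlg K) (I : Submodule K A) : Prop where
  mul_mem : ∀ a : A, ∀ x ∈ I, a * x ∈ I
  proj_mem : ∀ i, ∀ x ∈ I, A.proj i x ∈ I
  d_mem : ∀ x ∈ I, A.d x ∈ I

/-- Graded commutativity turns right multiples of the homogeneous components of `x`, which lie in
`I`, into left multiples up to sign. -/
theorem IsDGIdeal.mul_mem_right {A : DGAlg K} {I : Submodule K A} (h : A.IsDGIdeal I) {x : A}
    (hx : x ∈ I) (a : A) : x * a ∈ I := by
  induction a using A.gr_induction with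
  | h0 => simp
  | hadd a b ha hb => rw [mul_add]; exact add_mem ha hb
  | hgr j a ha =>
    obtain ⟨s, hs⟩ := A.exists_sum_proj x
    rw [hs, Finset.sum_mul]
    refine Submodule.sum_mem _ fun i _ => ?_
    rw [A.comm (A.proj_mem i x) ha, Units.smul_def]
    exact zsmul_mem (h.mul_mem _ _ (h.proj_mem _ _ hx)) _

section quotient

variable (A : DGAlg K) (I : Submodule K A)

/-- The multiplication of the quotient by an ideal. -/
def quotMul (h : A.IsDGIdeal I) : (A ⧸ I) →ₗ[K] (A ⧸ I) →ₗ[K] (A ⧸ I) :=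
  I.liftQ
    { toFun := fun a => I.mapQ I (LinearMap.mulLeft K a) (fun x hx => h.mul_mem a x hx)
      map_add' := fun a b => by
        refine Submodule.linearMap_qext _ (LinearMap.ext fun x => ?_)
        exact congrArg I.mkQ (add_mul a b x)
      map_smul' := fun c a => by
        refine Submodule.linearMap_qext _ (LinearMap.ext fun x => ?_)
        exact congrArg I.mkQ (smul_mul_assoc c a x) }
    (fun x hx => by
      refine Submodule.linearMap_qext _ (LinearMap.ext fun a => ?_)
      exact (Submodule.Quotient.mk_eq_zero I).mpr (h.mul_mem_right hx a))

/-- The ring structure of the quotient by a differential graded ideal. -/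
abbrev quotRing (h : A.IsDGIdeal I) : NonUnitalRing (A ⧸ I) :=
  { (inferInstance : AddCommGroup (A ⧸ I)) with
    mul := fun x y => A.quotMul I h x y
    left_distrib := fun x y z => map_add (A.quotMul I h x) y z
    right_distrib := fun x y z => LinearMap.map_add₂ (A.quotMul I h) x y z
    zero_mul := fun x => LinearMap.map_zero₂ (A.quotMul I h) x
    mul_zero := fun x => map_zero (A.quotMul I h x)
    mul_assoc := fun x y z => by
      obtain ⟨x, rfl⟩ := I.mkQ_surjective x
      obtain ⟨y, rfl⟩ := I.mkQ_surjective y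
      obtain ⟨z, rfl⟩ := I.mkQ_surjective z
      exact congrArg I.mkQ (mul_assoc x y z) }

/-- The quotient by a differential graded ideal. -/
def quot (h : A.IsDGIdeal I) : DGAlg K where
  carrier := A ⧸ I
  ring := A.quotRing I h
  module := Submodule.Quotient.module I
  tower :=
    letI := A.quotRing I h
    ⟨fun c x y => LinearMap.map_smul₂ (A.quotMul I h) c x y⟩
  smulComm :=
    letI := A.quotRing I h
    ⟨fun c x y => (map_smul (A.quotMul I h x) c y).symm⟩
  gr := fun i => (A.gr i).map I.mkQ
  isInternal := isInternal_of_proj (M := A ⧸ I) _ (fun i => I.mapQ I (A.proj i) (h.proj_mem i))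
    (fun i x => by
      obtain ⟨x, rfl⟩ := I.mkQ_surjective x
      exact ⟨A.proj i x, A.proj_mem i x, rfl⟩)
    (fun i x hx => by
      obtain ⟨x, hx, rfl⟩ := hx
      exact congrArg I.mkQ (A.proj_same hx))
    (fun i j hij x hx => by
      obtain ⟨x, hx, rfl⟩ := hx
      exact (congrArg I.mkQ (A.proj_ne hx hij)).trans (map_zero _))
    (fun x => by
      obtain ⟨x, rfl⟩ := I.mkQ_surjective x
      refine (A.proj_finite x).subset fun i hi h0 => hi ?_
      exact (congrArg I.mkQ h0).trans (map_zero _))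
    (fun x hx => by
      obtain ⟨x, rfl⟩ := I.mkQ_surjective x
      obtain ⟨s, hs⟩ := A.exists_sum_proj x
      rw [hs, map_sum]
      exact Finset.sum_eq_zero fun i _ => hx i)
  mul_mem := by
    rintro i j _ _ ⟨a, ha, rfl⟩ ⟨b, hb, rfl⟩
    exact ⟨a * b, A.mul_mem ha hb, rfl⟩
  comm := by
    rintro i j _ _ ⟨a, ha, rfl⟩ ⟨b, hb, rfl⟩
    refine (congrArg I.mkQ (A.comm ha hb)).trans ?_
    rw [Units.smul_def, Units.smul_def, map_zsmul]
    rfl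
  d := I.mapQ I A.d h.d_mem
  d_mem := by
    rintro i _ ⟨a, ha, rfl⟩
    exact ⟨A.d a, A.d_mem ha, rfl⟩
  d_d := fun x => by
    obtain ⟨x, rfl⟩ := I.mkQ_surjective x
    exact (congrArg I.mkQ (A.d_d x)).trans (map_zero _)
  leibniz := by
    rintro i _ b ⟨a, ha, rfl⟩
    obtain ⟨b, rfl⟩ := I.mkQ_surjective b
    refine (congrArg I.mkQ (A.leibniz b ha)).trans ?_
    rw [Units.smul_def, Units.smul_def, map_add, map_zsmul]
    rfl

/-- The quotient morphism. -/
def quotMk (h : A.IsDGIdeal I) : Hom A (A.quot I h) where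
  toFun := fun a => I.mkQ a
  map_smul' := fun c a => map_smul I.mkQ c a
  map_zero' := map_zero I.mkQ
  map_add' := fun a b => map_add I.mkQ a b
  map_mul' := fun _ _ => rfl
  map_gr := fun {_ a} ha => ⟨a, ha, rfl⟩
  map_d := fun _ => rfl

theorem quotMk_surjective (h : A.IsDGIdeal I) : Function.Surjective (A.quotMk I h) :=
  I.mkQ_surjective

theorem quotMk_eq_zero (h : A.IsDGIdeal I) {a : A} : A.quotMk I h a = 0 ↔ a ∈ I :=
  Submodule.Quotient.mk_eq_zero I

variable {A I} in
/-- The morphism induced on the quotient by a morphism which vanishes on the ideal. -/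
def quotLift (h : A.IsDGIdeal I) {B : DGAlg K} (f : Hom A B) (hf : ∀ x ∈ I, f x = 0) :
    Hom (A.quot I h) B where
  toFun := fun x => I.liftQ (f.toNonUnitalAlgHom : A →ₗ[K] B) hf x
  map_smul' := fun c x => map_smul (I.liftQ (f.toNonUnitalAlgHom : A →ₗ[K] B) hf) c x
  map_zero' := map_zero (I.liftQ (f.toNonUnitalAlgHom : A →ₗ[K] B) hf)
  map_add' := fun x y => map_add (I.liftQ (f.toNonUnitalAlgHom : A →ₗ[K] B) hf) x y
  map_mul' := fun x y => by
    obtain ⟨x, rfl⟩ := I.mkQ_surjective x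
    obtain ⟨y, rfl⟩ := I.mkQ_surjective y
    exact map_mul f.toNonUnitalAlgHom x y
  map_gr := by
    rintro i _ ⟨a, ha, rfl⟩
    exact f.map_gr ha
  map_d := fun x => by
    obtain ⟨x, rfl⟩ := I.mkQ_surjective x
    exact f.map_d x

end quotient

end DGAlg

/-! ### Compositions of acyclic small extensions -/

namespace NilDGA

variable {K : Type u} [Field K]

/-- The quotient by a differential graded ideal. -/
def quot (A : NilDGA K) (I : Submodule K A.carrier) (h : A.IsDGIdeal I) : NilDGA K where
  toDGAlg := A.toDGAlg.quot I h
  finite := by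
    have := A.finite
    exact inferInstanceAs (Module.Finite K (A.carrier ⧸ I))
  nilpotent := by
    obtain ⟨n, hn⟩ := A.nilpotent
    refine ⟨n, eq_bot_iff.mpr fun x hx => ?_⟩
    obtain ⟨a, ha, rfl⟩ := (A.quotMk I h).exists_mem_pow (A.quotMk_surjective I h) hx
    rw [hn, Submodule.mem_bot] at ha
    rw [ha, map_zero]
    exact zero_mem _

/-- Compositions of acyclic small extensions. -/
inductive IsAcyclicTower : ∀ {A B : NilDGA K}, (A ⟶ B) → Prop
  | small {A B : NilDGA K} (p : A ⟶ B) : IsAcyclicSmallExtension p → IsAcyclicTower p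
  | comp {A B C : NilDGA K} (p : A ⟶ B) (q : B ⟶ C) :
      IsAcyclicTower p → IsAcyclicTower q → IsAcyclicTower (p ≫ q)

theorem IsAcyclicTower.map_surjective {F : NilDGA K ⥤ Type w}
    (hF : ∀ {A B : NilDGA K} (p : A ⟶ B), IsAcyclicSmallExtension p → Function.Surjective (F.map p))
    {A B : NilDGA K} {p : A ⟶ B} (hp : IsAcyclicTower p) : Function.Surjective (F.map p) := by
  induction hp with
  | small p hp => exact hF p hp
  | comp p q _ _ ihp ihq =>
    intro z
    obtain ⟨y, rfl⟩ := ihq z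
    obtain ⟨x, rfl⟩ := ihp y
    exact ⟨x, Functor.map_comp_apply F p q x⟩

/-- Only injectivity on small extensions is assumed, so that this applies to the homotopy quotient
before it is known to be a deformation functor. -/
theorem IsAcyclicTower.map_injective {F : NilDGA K ⥤ Type w}
    (hF : ∀ {A B : NilDGA K} (p : A ⟶ B), IsAcyclicSmallExtension p → Function.Injective (F.map p))
    {A B : NilDGA K} {p : A ⟶ B} (hp : IsAcyclicTower p) : Function.Injective (F.map p) := by
  induction hp with
  | small p hp => exact hF p hp
  | comp p q _ _ ihp ihq =>
    intro x y h
    rw [Functor.map_comp_apply, Functor.map_comp_apply] at h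
    exact ihp (ihq h)

/-- A surjective morphism is a composition of acyclic small extensions if its kernel has a finite
filtration by acyclic ideals `I k` with `A (I k) ⊆ I (k + 1)`. -/
theorem IsAcyclicTower.of_filtration (N : ℕ) {A B : NilDGA K} (f : A ⟶ B)
    (hf : Function.Surjective f) (I : ℕ → Submodule K A.carrier)
    (hI : ∀ k, A.IsDGIdeal (I k)) (hzero : ∀ x, x ∈ I 0 ↔ f x = 0) (hanti : Antitone I)
    (hmul : ∀ k, ∀ a, ∀ x ∈ I k, a * x ∈ I (k + 1))
    (hacyc : ∀ k, ∀ x ∈ I k, A.d x = 0 → ∃ y ∈ I k, A.d y = x) (hN : I N = ⊥) :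
    IsAcyclicTower f := by
  induction N generalizing A with
  | zero =>
    -- Here the kernel is zero, and a bijection is trivially an acyclic small extension.
    have hinj : ∀ x, f x = 0 → x = 0 := fun x hx => by
      rwa [← hzero, hN, Submodule.mem_bot] at hx
    exact .small f ⟨hf, fun a x hx => by rw [hinj x hx, mul_zero],
      fun x hx _ => ⟨0, map_zero _, by rw [hinj x hx, map_zero]⟩⟩
  | succ N ih =>
    -- The deepest ideal is divided out first: `A (I N) ⊆ I (N + 1) = 0`, so this quotient is a
    -- small extension, and the images of the `I k` filter the kernel of the remaining map with one
    -- term fewer.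
    let q : A ⟶ A.quot (I N) (hI N) := A.quotMk (I N) (hI N)
    have hq : ∀ {x}, q x = 0 ↔ x ∈ I N := A.quotMk_eq_zero (I N) (hI N)
    have hqs : Function.Surjective q := A.quotMk_surjective (I N) (hI N)
    let g : A.quot (I N) (hI N) ⟶ B :=
      DGAlg.quotLift (hI N) f fun x hx => (hzero x).mp (hanti (Nat.zero_le N) hx)
    have hg : ∀ x, g (q x) = f x := fun _ => rfl
    refine .comp q g (.small q ⟨hqs, fun a x hx => ?_, fun x hx hdx => ?_⟩) (ih g ?_
      (fun k => (I k).map (I N).mkQ) (fun k => ⟨?_, ?_, ?_⟩) ?_ ?_ ?_ ?_ ?_)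
    · have := hmul N a x (hq.mp hx)
      rwa [hN, Submodule.mem_bot] at this
    · obtain ⟨y, hy, hyx⟩ := hacyc N x (hq.mp hx) hdx
      exact ⟨y, hq.mpr hy, hyx⟩
    · intro b
      obtain ⟨a, rfl⟩ := hf b
      exact ⟨q a, rfl⟩
    · rintro a _ ⟨x, hx, rfl⟩
      obtain ⟨a, rfl⟩ := hqs a
      exact ⟨a * x, (hI k).mul_mem a x hx, rfl⟩
    · rintro i _ ⟨x, hx, rfl⟩
      exact ⟨A.proj i x, (hI k).proj_mem i x hx, q.map_proj i x⟩
    · rintro _ ⟨x, hx, rfl⟩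
      exact ⟨A.d x, (hI k).d_mem x hx, rfl⟩
    · intro x
      obtain ⟨x, rfl⟩ := hqs x
      rw [hg]
      constructor
      · rintro ⟨y, hy, hyx⟩
        exact ((hg x).symm.trans (congrArg g hyx.symm)).trans ((hzero y).mp hy)
      · intro hx
        exact ⟨x, (hzero x).mpr hx, rfl⟩
    · exact fun k l hkl => Submodule.map_mono (hanti hkl)
    · rintro k a _ ⟨x, hx, rfl⟩
      obtain ⟨a, rfl⟩ := hqs a
      exact ⟨a * x, hmul k a x hx, rfl⟩
    · rintro k _ ⟨x, hx, rfl⟩ hdx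
      have hdx' : A.d x ∈ I N := hq.mp hdx
      -- The class of `x` is closed only modulo `I N`. Since `I N` is acyclic, the defect `d x` is
      -- `d y` with `y ∈ I N`, and `x - y` is then closed in `I k`. For `k ≥ N` the image of `I k`
      -- is zero.
      rcases le_total k N with hk | hk
      · obtain ⟨y, hy, hyx⟩ := hacyc N _ hdx' (A.d_d x)
        obtain ⟨z, hz, hzx⟩ := hacyc k (x - y) (sub_mem hx (hanti hk hy))
          (by rw [map_sub, hyx, sub_self])
        refine ⟨q z, ⟨z, hz, rfl⟩, ?_⟩
        refine (congrArg q hzx).trans ?_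
        rw [map_sub, hq.mpr hy, sub_zero]
        rfl
      · refine ⟨0, zero_mem _, ?_⟩
        rw [map_zero]
        exact (hq.mpr (hanti hk hx)).symm
    · rw [eq_bot_iff]
      rintro _ ⟨x, hx, rfl⟩
      exact hq.mpr hx

end NilDGA

/-! ### Ideals of differential graded algebras -/

namespace DGAlg

variable {K : Type u} [Field K]

section ideals

variable {A B : DGAlg K}

theorem IsDGIdeal.sgn_mem {I : Submodule K A} (h : A.IsDGIdeal I) {x : A} (hx : x ∈ I) :
    A.sgn x ∈ I := by
  obtain ⟨s, hs⟩ := A.exists_sum_proj x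
  rw [hs, map_sum]
  refine Submodule.sum_mem _ fun i _ => ?_
  rw [A.sgn_of_mem (A.proj_mem i x), Units.smul_def]
  exact zsmul_mem (h.proj_mem _ _ hx) _

theorem IsDGIdeal.inf {I J : Submodule K A} (hI : A.IsDGIdeal I) (hJ : A.IsDGIdeal J) :
    A.IsDGIdeal (I ⊓ J) where
  mul_mem := fun a x hx => ⟨hI.mul_mem a x hx.1, hJ.mul_mem a x hx.2⟩
  proj_mem := fun i x hx => ⟨hI.proj_mem i x hx.1, hJ.proj_mem i x hx.2⟩
  d_mem := fun x hx => ⟨hI.d_mem x hx.1, hJ.d_mem x hx.2⟩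

theorem IsDGIdeal.comap (f : Hom A B) {I : Submodule K B} (hI : B.IsDGIdeal I) :
    A.IsDGIdeal (I.comap (f.toNonUnitalAlgHom : A →ₗ[K] B)) where
  mul_mem := fun a x hx => by
    have := hI.mul_mem (f a) (f x) hx
    rwa [← map_mul] at this
  proj_mem := fun i x hx => by
    have := hI.proj_mem i (f x) hx
    rwa [← f.map_proj] at this
  d_mem := fun x hx => by
    have := hI.d_mem (f x) hx
    rwa [← f.map_d] at this

theorem isDGIdeal_top (A : DGAlg K) : A.IsDGIdeal ⊤ :=
  ⟨fun _ _ _ => trivial, fun _ _ _ => trivial, fun _ _ => trivial⟩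

theorem isDGIdeal_bot (A : DGAlg K) : A.IsDGIdeal ⊥ where
  mul_mem := fun a x hx => by
    rw [Submodule.mem_bot] at *
    rw [hx, mul_zero]
  proj_mem := fun i x hx => by
    rw [Submodule.mem_bot] at *
    rw [hx, map_zero]
  d_mem := fun x hx => by
    rw [Submodule.mem_bot] at *
    rw [hx, map_zero]

theorem mul_mem_pow_succ' (A : DGAlg K) {n : ℕ} (a : A) {b : A} (h : b ∈ A.pow n) :
    a * b ∈ A.pow (n + 1) := by
  have := A.mul_mem_pow (m := 1) (a := a) Submodule.mem_top h
  rwa [add_comm] at this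

theorem isDGIdeal_pow (A : DGAlg K) (n : ℕ) : A.IsDGIdeal (A.pow n) where
  mul_mem := fun a _ hx => A.pow_succ_le n (A.mul_mem_pow_succ' a hx)
  proj_mem := fun i _ hx => A.proj_mem_pow hx i
  d_mem := fun _ hx => A.d_mem_pow hx

/-- The kernel of a morphism. -/
def Hom.ker (f : Hom A B) : Submodule K A := LinearMap.ker (f.toNonUnitalAlgHom : A →ₗ[K] B)

theorem Hom.mem_ker (f : Hom A B) {a : A} : a ∈ f.ker ↔ f a = 0 := Iff.rfl

theorem Hom.isDGIdeal_ker (f : Hom A B) : A.IsDGIdeal f.ker := B.isDGIdeal_bot.comap f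

end ideals

/-! ### Coefficients in `A[t, dt]_ε` -/

section path

variable {A : DGAlg K} {ε : ℝ}

/-- The function part `∑ p_n ⊗ t ^ n` of an element of `A[t, dt]_ε`. -/
def pathFst : A.path ε →ₗ[K] (ℕ →₀ A) where
  toFun := fun x => A.formsFst x.1
  map_add' := fun _ _ => rfl
  map_smul' := fun _ _ => rfl

/-- The form part `∑ q_n ⊗ t ^ n dt` of an element of `A[t, dt]_ε`. -/
def pathSnd : A.path ε →ₗ[K] (ℕ →₀ A) where
  toFun := fun x => A.formsSnd x.1
  map_add' := fun _ _ => rfl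
  map_smul' := fun _ _ => rfl

theorem pathFst_mem (x : A.path ε) (n : ℕ) : pathFst x n ∈ A.pow ⌈(n : ℝ) * ε⌉₊ := x.2.1 n

theorem pathSnd_mem (x : A.path ε) (n : ℕ) : pathSnd x n ∈ A.pow ⌈((n + 1 : ℕ) : ℝ) * ε⌉₊ :=
  x.2.2 n

/-- The element of `A[t, dt]_ε` with given coefficients. -/
def pathMk (p q : ℕ →₀ A) (hp : ∀ n : ℕ, p n ∈ A.pow ⌈(n : ℝ) * ε⌉₊)
    (hq : ∀ n : ℕ, q n ∈ A.pow ⌈((n + 1 : ℕ) : ℝ) * ε⌉₊) : A.path ε :=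
  ⟨((p, q) : (ℕ →₀ A) × (ℕ →₀ A)), hp, hq⟩

@[simp]
theorem pathFst_mk (p q : ℕ →₀ A) (hp : ∀ n : ℕ, p n ∈ A.pow ⌈(n : ℝ) * ε⌉₊)
    (hq : ∀ n : ℕ, q n ∈ A.pow ⌈((n + 1 : ℕ) : ℝ) * ε⌉₊) : pathFst (pathMk p q hp hq) = p := rfl

@[simp]
theorem pathSnd_mk (p q : ℕ →₀ A) (hp : ∀ n : ℕ, p n ∈ A.pow ⌈(n : ℝ) * ε⌉₊)
    (hq : ∀ n : ℕ, q n ∈ A.pow ⌈((n + 1 : ℕ) : ℝ) * ε⌉₊) : pathSnd (pathMk p q hp hq) = q := rfl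

theorem path_ext {x y : A.path ε} (h₁ : pathFst x = pathFst y) (h₂ : pathSnd x = pathSnd y) :
    x = y := Subtype.ext (Forms.ext h₁ h₂)

theorem pathFst_mul (x y : A.path ε) : pathFst (x * y) = A.polyMul (pathFst x) (pathFst y) := rfl

theorem pathSnd_mul (x y : A.path ε) : pathSnd (x * y) =
    A.polyMul (pathFst x) (pathSnd y) + A.polyMul (pathSnd x) (A.polyMap A.sgn (pathFst y)) := rfl

theorem pathFst_d (x : A.path ε) : pathFst ((A.path ε).d x) = A.polyMap A.d (pathFst x) := rfl

theorem pathSnd_d (x : A.path ε) : pathSnd ((A.path ε).d x) =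
    A.polyMap A.d (pathSnd x) + A.polyMap A.sgn (A.polyDeriv (pathFst x)) := rfl

theorem path_proj (i : ℤ) (x : A.path ε) : ((A.path ε).proj i x).1 = Forms.proj A i x.1 :=
  (Hom.map_proj (subIncl _ _ _ _) i x).trans (A.forms_proj i x.1)

theorem pathFst_proj (i : ℤ) (x : A.path ε) :
    pathFst ((A.path ε).proj i x) = A.polyMap (A.proj i) (pathFst x) :=
  congrArg Prod.fst (path_proj i x)

theorem pathSnd_proj (i : ℤ) (x : A.path ε) :
    pathSnd ((A.path ε).proj i x) = A.polyMap (A.proj (i - 1)) (pathSnd x) :=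
  congrArg Prod.snd (path_proj i x)

theorem pathEval_apply (s : K) (x : A.path ε) : A.pathEval ε s x = A.polyEval s (pathFst x) := rfl

theorem polyEval_mem_submodule {V : Submodule K A} (s : K) {p : ℕ →₀ A} (h : ∀ n, p n ∈ V) :
    A.polyEval s p ∈ V := by
  rw [polyEval, Finsupp.lsum_apply]
  exact Submodule.sum_mem _ fun n _ => Submodule.smul_mem _ _ (h n)

/-- The convention `A ^ 0 = A` leaves constant terms unrestricted. -/
theorem mem_pow_zero_mul (ε : ℝ) (a : A) : a ∈ A.pow ⌈((0 : ℕ) : ℝ) * ε⌉₊ := by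
  rw [Nat.cast_zero, zero_mul, Nat.ceil_zero]
  exact Submodule.mem_top

/-- For `ε = 1` the coefficient of `t` is unrestricted as well, since `A ^ 1 = A`. This is why the
explicit linear paths are taken in `A[t, dt]_1`. -/
theorem mem_pow_one_mul (a : A) : a ∈ A.pow ⌈((1 : ℕ) : ℝ) * 1⌉₊ := by
  rw [Nat.cast_one, one_mul, Nat.ceil_one]
  exact Submodule.mem_top

/-- The elements of `A[t, dt]_ε` with coefficients in `V`. -/
def coeffs (ε : ℝ) (V : Submodule K A) : Submodule K (A.path ε) where
  carrier := {x | (∀ n, pathFst x n ∈ V) ∧ ∀ n, pathSnd x n ∈ V}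
  add_mem' := fun ha hb => ⟨fun n => add_mem (ha.1 n) (hb.1 n), fun n => add_mem (ha.2 n) (hb.2 n)⟩
  zero_mem' := ⟨fun _ => zero_mem _, fun _ => zero_mem _⟩
  smul_mem' := fun c _ ha =>
    ⟨fun n => Submodule.smul_mem _ c (ha.1 n), fun n => Submodule.smul_mem _ c (ha.2 n)⟩

theorem coeffs_mono {V W : Submodule K A} (h : V ≤ W) : coeffs ε V ≤ coeffs ε W :=
  fun _ hx => ⟨fun n => h (hx.1 n), fun n => h (hx.2 n)⟩

/-- Two subspaces are allowed so that multiplication can be seen to descend a filtration, or to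
vanish when `W = ⊥`. Stability under `sgn` is needed for the Koszul sign met when `dt` passes the
coefficients of `x`. -/
theorem mul_mem_coeffs {V W : Submodule K A} (hV : ∀ x ∈ V, A.sgn x ∈ V)
    (h : ∀ a : A, ∀ x ∈ V, a * x ∈ W) (a : A.path ε) {x : A.path ε} (hx : x ∈ coeffs ε V) :
    a * x ∈ coeffs ε W := by
  have key : ∀ p q : ℕ →₀ A, (∀ n, q n ∈ V) → ∀ n, A.polyMul p q n ∈ W := by
    intro p q hq n
    rw [polyMul_apply]
    exact Submodule.sum_mem _ fun _ _ => h _ _ (hq _)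
  refine ⟨key _ _ hx.1, fun n => ?_⟩
  rw [pathSnd_mul]
  refine add_mem (key _ _ hx.2 n) (key _ _ (fun m => ?_) n)
  rw [polyMap_apply]
  exact hV _ (hx.1 m)

theorem isDGIdeal_coeffs {V : Submodule K A} (h : A.IsDGIdeal V) :
    (A.path ε).IsDGIdeal (coeffs ε V) where
  mul_mem := fun a _ hx => mul_mem_coeffs (fun _ => h.sgn_mem) h.mul_mem a hx
  proj_mem := fun i x hx => by
    refine ⟨fun n => ?_, fun n => ?_⟩
    · rw [pathFst_proj, polyMap_apply]
      exact h.proj_mem _ _ (hx.1 n)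
    · rw [pathSnd_proj, polyMap_apply]
      exact h.proj_mem _ _ (hx.2 n)
  d_mem := fun x hx => by
    refine ⟨fun n => ?_, fun n => ?_⟩
    · rw [pathFst_d, polyMap_apply]
      exact h.d_mem _ (hx.1 n)
    · rw [pathSnd_d, Finsupp.add_apply, polyMap_apply, polyMap_apply, polyDeriv_apply]
      exact add_mem (h.d_mem _ (hx.2 n)) (h.sgn_mem (Submodule.smul_mem _ _ (hx.1 _)))

/-- The inclusion of constants. -/
def pathConst (A : DGAlg K) (ε : ℝ) : Hom A (A.path ε) where
  toFun := fun a => pathMk (Finsupp.single 0 a) 0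
    (fun n => by
      rcases n with _ | n
      · exact mem_pow_zero_mul ε _
      · simp)
    (fun n => zero_mem _)
  map_smul' := fun c a => path_ext (Finsupp.smul_single c 0 a).symm (smul_zero c).symm
  map_zero' := path_ext (Finsupp.single_zero 0) rfl
  map_add' := fun a b => path_ext (Finsupp.single_add 0 a b) (add_zero 0).symm
  map_mul' := fun a b => by
    refine path_ext ?_ ?_
    · rw [pathFst_mul, pathFst_mk, pathFst_mk, pathFst_mk, polyMul_single]
    · rw [pathSnd_mul, pathSnd_mk, pathSnd_mk, pathSnd_mk, map_zero, map_zero,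
        LinearMap.zero_apply, add_zero]
  map_gr := fun {i a} ha => by
    refine ⟨fun n => ?_, fun n => zero_mem _⟩
    change (Finsupp.single 0 a : ℕ →₀ A) n ∈ A.gr i
    rcases n with _ | n
    · simpa using ha
    · simp
  map_d := fun a => by
    refine path_ext ?_ ?_
    · exact (A.polyMap_single _ _ _).symm
    · change 0 = A.polyMap A.d 0 + A.polyMap A.sgn (A.polyDeriv (Finsupp.single 0 a))
      simp

theorem pathFst_const (a : A) : pathFst (A.pathConst ε a) = Finsupp.single 0 a := rfl

theorem pathSnd_const (a : A) : pathSnd (A.pathConst ε a) = 0 := rfl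

theorem pathEval_const (s : K) (a : A) : A.pathEval ε s (A.pathConst ε a) = a := by
  rw [pathEval_apply, pathFst_const, polyEval_single, pow_zero, one_smul]

/-- The path `a + b t`. -/
def pathLinear (a b : A) : A.path 1 :=
  pathMk (Finsupp.single 0 a + Finsupp.single 1 b) 0
    (fun n => by
      rcases n with _ | _ | n
      · exact mem_pow_zero_mul 1 _
      · exact mem_pow_one_mul _
      · simp)
    (fun n => zero_mem _)

theorem pathEval_linear (s : K) (a b : A) : A.pathEval 1 s (pathLinear a b) = a + s • b := by
  rw [pathEval_apply, pathLinear, pathFst_mk, map_add, polyEval_single, polyEval_single, pow_zero,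
    one_smul, pow_one]

theorem pathLinear_mem_coeffs {V : Submodule K A} {a b : A} (ha : a ∈ V) (hb : b ∈ V) :
    pathLinear a b ∈ coeffs 1 V := by
  refine ⟨fun n => add_mem ?_ ?_, fun n => zero_mem _⟩
  · rw [Finsupp.single_apply]
    split_ifs
    exacts [ha, zero_mem _]
  · rw [Finsupp.single_apply]
    split_ifs
    exacts [hb, zero_mem _]

/-! ### Functoriality of `A[t, dt]_ε` -/

section functoriality

variable {B : DGAlg K}

/-- A morphism applied to the coefficients of a polynomial. -/
def Hom.polyMap (f : Hom A B) : (ℕ →₀ A) →ₗ[K] (ℕ →₀ B) :=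
  Finsupp.mapRange.linearMap (f.toNonUnitalAlgHom : A →ₗ[K] B)

theorem Hom.polyMap_apply (f : Hom A B) (p : ℕ →₀ A) (n : ℕ) : f.polyMap p n = f (p n) := by
  simp [Hom.polyMap]

theorem Hom.polyMap_mul (f : Hom A B) (p q : ℕ →₀ A) :
    f.polyMap (A.polyMul p q) = B.polyMul (f.polyMap p) (f.polyMap q) := by
  ext n
  simp only [Hom.polyMap_apply, polyMul_apply, map_sum, map_mul]

/-- The functoriality of `A[t, dt]_ε` in `A`. -/
def Hom.path (f : Hom A B) (ε : ℝ) : Hom (A.path ε) (B.path ε) where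
  toFun := fun x => pathMk (f.polyMap (pathFst x)) (f.polyMap (pathSnd x))
    (fun n => by rw [f.polyMap_apply]; exact f.map_pow (pathFst_mem x n))
    (fun n => by rw [f.polyMap_apply]; exact f.map_pow (pathSnd_mem x n))
  map_smul' := fun c x => path_ext (map_smul f.polyMap c (pathFst x))
    (map_smul f.polyMap c (pathSnd x))
  map_zero' := path_ext (map_zero f.polyMap) (map_zero f.polyMap)
  map_add' := fun x y => path_ext (map_add f.polyMap (pathFst x) (pathFst y))
    (map_add f.polyMap (pathSnd x) (pathSnd y))
  map_mul' := fun x y => by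
    refine path_ext (f.polyMap_mul _ _) ?_
    rw [pathSnd_mk, pathSnd_mul, pathSnd_mul, map_add, f.polyMap_mul, f.polyMap_mul]
    congr 2
    ext n
    simp only [pathFst_mk, Hom.polyMap_apply, DGAlg.polyMap_apply, f.map_sgn]
  map_gr := fun {i x} hx => by
    refine ⟨fun n => ?_, fun n => ?_⟩
    · change f.polyMap (pathFst x) n ∈ B.gr i
      rw [f.polyMap_apply]
      exact f.map_gr (hx.1 n)
    · change f.polyMap (pathSnd x) n ∈ B.gr (i - 1)
      rw [f.polyMap_apply]
      exact f.map_gr (hx.2 n)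
  map_d := fun x => by
    refine path_ext ?_ ?_
    · change f.polyMap (A.polyMap A.d (pathFst x)) = B.polyMap B.d (f.polyMap (pathFst x))
      ext n
      simp only [Hom.polyMap_apply, DGAlg.polyMap_apply, f.map_d]
    · change f.polyMap (A.polyMap A.d (pathSnd x) + A.polyMap A.sgn (A.polyDeriv (pathFst x))) =
        B.polyMap B.d (f.polyMap (pathSnd x)) +
          B.polyMap B.sgn (B.polyDeriv (f.polyMap (pathFst x)))
      ext n
      simp only [Hom.polyMap_apply, DGAlg.polyMap_apply,
        Finsupp.add_apply, polyDeriv_apply, map_add, map_smul, f.map_d, f.map_sgn]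

theorem Hom.pathFst_path (f : Hom A B) (x : A.path ε) (n : ℕ) :
    pathFst (f.path ε x) n = f (pathFst x n) := f.polyMap_apply _ n

theorem Hom.pathSnd_path (f : Hom A B) (x : A.path ε) (n : ℕ) :
    pathSnd (f.path ε x) n = f (pathSnd x n) := f.polyMap_apply _ n

theorem Hom.pathEval_path (f : Hom A B) (s : K) (x : A.path ε) :
    B.pathEval ε s (f.path ε x) = f (A.pathEval ε s x) := by
  change B.polyEval s (f.polyMap (pathFst x)) = f (A.polyEval s (pathFst x))
  induction pathFst x using Finsupp.induction_linear with
  | zero => simp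
  | add p q hp hq => simp only [map_add, hp, hq]
  | single n a => simp [Hom.polyMap]

theorem Hom.path_eq_zero (f : Hom A B) (x : A.path ε) :
    f.path ε x = 0 ↔ x ∈ coeffs ε f.ker := by
  constructor
  · intro h
    refine ⟨fun n => ?_, fun n => ?_⟩
    · rw [f.mem_ker, ← f.pathFst_path, h]; rfl
    · rw [f.mem_ker, ← f.pathSnd_path, h]; rfl
  · intro h
    refine path_ext (Finsupp.ext fun n => ?_) (Finsupp.ext fun n => ?_)
    · rw [f.pathFst_path]; exact h.1 n
    · rw [f.pathSnd_path]; exact h.2 n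

theorem Hom.polyMap_surjective_of_mem (f : Hom A B) (hf : Function.Surjective f) (m : ℕ → ℕ)
    (q : ℕ →₀ B) (hq : ∀ n, q n ∈ B.pow (m n)) :
    ∃ p : ℕ →₀ A, (∀ n, p n ∈ A.pow (m n)) ∧ f.polyMap p = q := by
  classical
  choose g hg using fun n => f.exists_mem_pow hf (hq n)
  -- The chosen lift of a zero coefficient is replaced by `0` to keep the support finite.
  refine ⟨Finsupp.onFinset q.support (fun n => if q n = 0 then 0 else g n) ?_, fun n => ?_, ?_⟩
  · intro n hn
    rw [Finsupp.mem_support_iff]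
    intro h
    simp [h] at hn
  · rw [Finsupp.onFinset_apply]
    split_ifs
    exacts [zero_mem _, (hg n).1]
  · ext n
    rw [f.polyMap_apply, Finsupp.onFinset_apply]
    split_ifs with h
    · rw [map_zero, h]
    · exact (hg n).2

/-- The growth condition on coefficients is respected because a surjection maps `A ^ n` onto `B ^
n`. -/
theorem Hom.path_surjective (f : Hom A B) (hf : Function.Surjective f) (ε : ℝ) :
    Function.Surjective (f.path ε) := by
  intro y
  obtain ⟨p, hp, hpy⟩ := f.polyMap_surjective_of_mem hf _ (pathFst y) (pathFst_mem y)
  obtain ⟨q, hq, hqy⟩ := f.polyMap_surjective_of_mem hf _ (pathSnd y) (pathSnd_mem y)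
  exact ⟨pathMk p q hp hq, path_ext hpy hqy⟩

end functoriality

/-! ### Integration of closed forms -/

section integration

/-- The formal integral from `0` of a polynomial. -/
def polyInt (A : DGAlg K) : (ℕ →₀ A) →ₗ[K] (ℕ →₀ A) :=
  Finsupp.lsum K fun n => ((n + 1 : ℕ) : K)⁻¹ • Finsupp.lsingle (n + 1)

theorem polyInt_single (n : ℕ) (a : A) :
    A.polyInt (Finsupp.single n a) = Finsupp.single (n + 1) (((n + 1 : ℕ) : K)⁻¹ • a) := by
  simp [polyInt]

theorem polyInt_apply_zero (p : ℕ →₀ A) : A.polyInt p 0 = 0 := by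
  induction p using Finsupp.induction_linear with
  | zero => simp
  | add p q hp hq => simp [hp, hq]
  | single n a => rw [polyInt_single]; simp

theorem polyInt_apply_succ (p : ℕ →₀ A) (n : ℕ) :
    A.polyInt p (n + 1) = ((n + 1 : ℕ) : K)⁻¹ • p n := by
  induction p using Finsupp.induction_linear with
  | zero => simp
  | add p q hp hq => simp only [map_add, Finsupp.add_apply, hp, hq, smul_add]
  | single m a =>
    rw [polyInt_single]
    by_cases h : m = n
    · subst h; simp
    · rw [Finsupp.single_eq_of_ne, Finsupp.single_eq_of_ne, smul_zero] <;> omega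

theorem polyMap_sgn_sgn (p : ℕ →₀ A) : A.polyMap A.sgn (A.polyMap A.sgn p) = p := by
  ext n
  simp only [polyMap_apply, sgn_sgn]

variable [CharZero K]

theorem polyDeriv_polyInt (p : ℕ →₀ A) : A.polyDeriv (A.polyInt p) = p := by
  ext n
  rw [polyDeriv_apply, polyInt_apply_succ, smul_smul,
    mul_inv_cancel₀ (Nat.cast_ne_zero.mpr n.succ_ne_zero), one_smul]

/-- In characteristic zero a polynomial with zero derivative is constant, hence equal to its value
at `s`. -/
theorem eq_zero_of_polyDeriv_eq_zero {p : ℕ →₀ A} (h : A.polyDeriv p = 0) (s : K)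
    (hs : A.polyEval s p = 0) : p = 0 := by
  have h1 : ∀ n, p (n + 1) = 0 := fun n => by
    have := DFunLike.congr_fun h n
    rw [polyDeriv_apply, Finsupp.zero_apply] at this
    exact (smul_eq_zero.mp this).resolve_left (Nat.cast_ne_zero.mpr n.succ_ne_zero)
  have h2 : p = Finsupp.single 0 (p 0) := by
    ext n
    rcases n with _ | n
    · simp
    · simp [h1]
  rw [h2, polyEval_single, pow_zero, one_smul] at hs
  rw [h2, hs, Finsupp.single_zero]

/-- A closed form which vanishes at `s` is the differential of a function which vanishes at `s`,
with control on the coefficients. -/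
theorem exists_d_eq_of_eval_eq_zero (V : ℕ → Submodule K A) (hV : ∀ n, V n ≤ V 0)
    (hsgn : ∀ n, ∀ a ∈ V n, A.sgn a ∈ V n) (hpow : ∀ n : ℕ, V n ≤ A.pow ⌈(n : ℝ) * ε⌉₊) (s : K)
    {x : A.path ε} (hx : ∀ n, pathSnd x n ∈ V (n + 1)) (hs : A.pathEval ε s x = 0)
    (hd : (A.path ε).d x = 0) :
    ∃ y : A.path ε, (∀ n, pathFst y n ∈ V n) ∧ pathSnd y = 0 ∧ A.pathEval ε s y = 0 ∧
      (A.path ε).d y = x := by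
  -- A function `p` has `dt`-part `sgn p'` in its differential, so `p' = sgn q` is forced, with `q`
  -- the form part of `x`. Integration shifts the index by one, which matches the bound on `q n` by
  -- `V (n + 1)`.
  let r : ℕ →₀ A := A.polyInt (A.polyMap A.sgn (pathSnd x))
  have hr : ∀ n, r n ∈ V n := by
    rintro (_ | n)
    · rw [polyInt_apply_zero]; exact zero_mem _
    · rw [polyInt_apply_succ, polyMap_apply]
      exact Submodule.smul_mem _ _ (hsgn _ _ (hx n))
  let c : A := A.polyEval s r
  -- The integration constant collects coefficients of every degree; this is where `V n ≤ V 0` is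
  -- needed.
  have hc : c ∈ V 0 := polyEval_mem_submodule s fun n => hV n (hr n)
  let p : ℕ →₀ A := r - Finsupp.single 0 c
  have hp : ∀ n, p n ∈ V n := fun n => by
    rw [Finsupp.sub_apply]
    refine sub_mem (hr n) ?_
    rcases n with _ | n
    · simpa using hc
    · simp
  have hps : A.polyEval s p = 0 := by
    rw [map_sub, polyEval_single, pow_zero, one_smul, sub_self]
  have hpd : A.polyDeriv p = A.polyMap A.sgn (pathSnd x) := by
    rw [map_sub, polyDeriv_polyInt, polyDeriv_single]
    simp
  refine ⟨pathMk p 0 (fun n => hpow n (hp n)) (fun n => zero_mem _), hp, rfl, hps, ?_⟩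
  refine path_ext ?_ ?_
  -- The difference of `d p` and the function part of `x` vanishes at `s`, and its derivative
  -- vanishes because `x` is closed and `sgn` anticommutes with `d`.
  · rw [pathFst_d, pathFst_mk, ← sub_eq_zero]
    refine eq_zero_of_polyDeriv_eq_zero ?_ s ?_
    · have h2 := congrArg pathSnd hd
      rw [pathSnd_d, map_zero] at h2
      have h3 := congrArg (A.polyMap A.sgn) h2
      rw [map_add, polyMap_sgn_sgn, map_zero, polyMap_sgn_d] at h3
      rw [map_sub, polyDeriv_polyMap, hpd, sub_eq_add_neg, ← neg_eq_zero, neg_add, neg_neg]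
      exact h3
    · rw [map_sub, polyEval_d, hps, map_zero, ← pathEval_apply, hs, sub_zero]
  · rw [pathSnd_d, pathFst_mk, pathSnd_mk, map_zero, zero_add, hpd, polyMap_sgn_sgn]

end integration

end path

end DGAlg

/-! ### Morphisms into fibre products, sums of morphisms -/

namespace DGAlg

variable {K : Type u} [Field K]

section homs

variable {A B C X : DGAlg K}

/-- The morphism to a fibre product given by a compatible pair of morphisms. -/
def fiberLift (α : Hom A C) (β : Hom B C) (f : Hom X A) (g : Hom X B)
    (h : ∀ x, α (f x) = β (g x)) : Hom X (fiber α β) where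
  toFun := fun x => ⟨((f x, g x) : A × B), h x⟩
  map_smul' := fun c x => Subtype.ext (Prod.ext (map_smul f.toNonUnitalAlgHom c x)
    (map_smul g.toNonUnitalAlgHom c x))
  map_zero' := Subtype.ext (Prod.ext (map_zero f.toNonUnitalAlgHom) (map_zero g.toNonUnitalAlgHom))
  map_add' := fun x y => Subtype.ext (Prod.ext (map_add f.toNonUnitalAlgHom x y)
    (map_add g.toNonUnitalAlgHom x y))
  map_mul' := fun x y => Subtype.ext (Prod.ext (map_mul f.toNonUnitalAlgHom x y)
    (map_mul g.toNonUnitalAlgHom x y))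
  map_gr := fun hx => ⟨f.map_gr hx, g.map_gr hx⟩
  map_d := fun x => Subtype.ext (Prod.ext (f.map_d x) (g.map_d x))

theorem fiber_ext {α : Hom A C} {β : Hom B C} {x y : fiber α β}
    (h₁ : fiberFst α β x = fiberFst α β y) (h₂ : fiberSnd α β x = fiberSnd α β y) : x = y :=
  Subtype.ext (Prod.ext h₁ h₂)

/-- The element of the fibre product given by a compatible pair. -/
def fiberMk {α : Hom A C} {β : Hom B C} (a : A) (b : B) (h : α a = β b) : fiber α β :=
  ⟨((a, b) : A × B), h⟩

theorem fiber_comm {α : Hom A C} {β : Hom B C} (x : fiber α β) :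
    α (fiberFst α β x) = β (fiberSnd α β x) := x.2

/-- The sum of two morphisms whose images annihilate each other. -/
def Hom.add (f g : Hom X A) (h₁ : ∀ x y, f x * g y = 0) (h₂ : ∀ x y, g x * f y = 0) : Hom X A where
  toFun := fun x => f x + g x
  map_smul' := fun c x => by simp
  map_zero' := by simp
  map_add' := fun x y => by simp only [map_add]; abel
  map_mul' := fun x y => by
    simp only [map_mul, add_mul, mul_add, h₁, h₂, add_zero, zero_add]
  map_gr := fun hx => add_mem (f.map_gr hx) (g.map_gr hx)
  map_d := fun x => by
    change f (X.d x) + g (X.d x) = A.d (f x + g x)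
    rw [f.map_d, g.map_d, map_add]

/-- The zero morphism. -/
def Hom.zero (A B : DGAlg K) : Hom A B where
  toFun := fun _ => 0
  map_smul' := fun _ _ => (smul_zero _).symm
  map_zero' := rfl
  map_add' := fun _ _ => (add_zero _).symm
  map_mul' := fun _ _ => (mul_zero _).symm
  map_gr := fun _ => zero_mem (B.gr _)
  map_d := fun _ => (map_zero B.d).symm

end homs

end DGAlg

/-! ### Acyclic towers built from path algebras -/

namespace NilDGA

variable {K : Type u} [Field K]

open DGAlg

/-- The inclusion of constants `A ⟶ A[t, dt]_ε`. -/
def pathConst (A : NilDGA K) (ε : ℝ) (hε : 0 < ε) : A ⟶ A.path ε hε := A.toDGAlg.pathConst ε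

/-- The functoriality of `A[t, dt]_ε` in `A`. -/
def pathMap {A B : NilDGA K} (f : A ⟶ B) (ε : ℝ) (hε : 0 < ε) : A.path ε hε ⟶ B.path ε hε :=
  DGAlg.Hom.path f ε

/-- The morphism to a fibre product given by a compatible pair of morphisms. -/
def fiberLift {A B C X : NilDGA K} (α : A ⟶ C) (β : B ⟶ C) (f : X ⟶ A) (g : X ⟶ B)
    (h : f ≫ α = g ≫ β) : X ⟶ fiber α β :=
  DGAlg.fiberLift α β f g fun x => congrArg (fun k : X ⟶ C => k x) h

theorem hom_ext {A B : NilDGA K} {f g : A ⟶ B} (h : ∀ x, f x = g x) : f = g :=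
  DGAlg.Hom.ext (funext h)

theorem pathConst_eval (A : NilDGA K) (ε : ℝ) (hε : 0 < ε) (s : K) :
    pathConst A ε hε ≫ A.pathEval ε hε s = 𝟙 A :=
  hom_ext fun a => DGAlg.pathEval_const s a

theorem pathMap_eval {A B : NilDGA K} (f : A ⟶ B) (ε : ℝ) (hε : 0 < ε) (s : K) :
    pathMap f ε hε ≫ B.pathEval ε hε s = A.pathEval ε hε s ≫ f :=
  hom_ext fun x => f.pathEval_path s x

/-- The algebra of the paths in `A` whose image in `B` is constant. -/
def relativePath {A B : NilDGA K} (p : A ⟶ B) : NilDGA K :=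
  fiber (pathMap p 1 one_pos) (pathConst B 1 one_pos)

/-- The underlying path of a path with constant image. -/
def relativePathIncl {A B : NilDGA K} (p : A ⟶ B) : relativePath p ⟶ A.path 1 one_pos :=
  fiberFst _ _

/-- All values of a path with constant image lie over the same element of `B`; comparing `s = 0` and
`s = 1` shows that its two ends define an element of `A ×_B A`. -/
theorem relativePath_condition {A B : NilDGA K} (p : A ⟶ B) (s : K) :
    (relativePathIncl p ≫ A.pathEval 1 one_pos s) ≫ p = fiberSnd _ _ := by
  refine hom_ext fun x => (DGAlg.Hom.pathEval_path p s (relativePathIncl p x)).symm.trans ?_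
  refine (congrArg (B.pathEval 1 one_pos s) (fiber_comm x)).trans ?_
  exact DGAlg.pathEval_const s _

/-- The origin and the end of a path with constant image. -/
def relativePathEnds {A B : NilDGA K} (p : A ⟶ B) : relativePath p ⟶ fiber p p :=
  fiberLift _ _ (relativePathIncl p ≫ A.pathEval 1 one_pos 0)
    (relativePathIncl p ≫ A.pathEval 1 one_pos 1)
    ((relativePath_condition p 0).trans (relativePath_condition p 1).symm)

variable [CharZero K]

/-- A surjection from `A[t, dt]_ε` whose kernel consists of the forms which vanish at `t = s` and
have coefficients in a given ideal. -/
theorem IsAcyclicTower.of_path {A B : NilDGA K} {ε : ℝ} {hε : 0 < ε} (s : K)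
    {U : Submodule K A.carrier} (hU : A.IsDGIdeal U) (f : A.path ε hε ⟶ B)
    (hf : Function.Surjective f)
    (hker : ∀ x, f x = 0 ↔ x ∈ coeffs ε U ∧ A.pathEval ε hε s x = 0) : IsAcyclicTower f := by
  obtain ⟨N, hN⟩ := A.nilpotent
  refine .of_filtration N f hf
    -- The term `k = 0` is the whole kernel as `A ^ 0 = A`, and the term `N` vanishes by nilpotency.
    (fun k => DGAlg.Hom.ker f ⊓ coeffs ε (A.pow k))
    (fun k => (DGAlg.Hom.isDGIdeal_ker f).inf (isDGIdeal_coeffs (A.isDGIdeal_pow k)))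
    (fun x => ⟨fun h => h.1, fun h => ⟨h, fun _ => Submodule.mem_top, fun _ => Submodule.mem_top⟩⟩)
    (fun k l hkl x hx => ⟨hx.1, coeffs_mono (A.pow_antitone hkl) hx.2⟩)
    (fun k a x hx => ⟨(DGAlg.Hom.isDGIdeal_ker f).mul_mem a x hx.1,
      mul_mem_coeffs (fun _ => A.sgn_mem_pow) (fun a _ h => A.mul_mem_pow_succ' a h) a hx.2⟩)
    (fun k x hx hd => ?_) ?_
  · obtain ⟨hxU, hxs⟩ := (hker x).mp hx.1
    obtain ⟨y, hy1, hy2, hys, hyx⟩ := exists_d_eq_of_eval_eq_zero (A := A.toDGAlg) (ε := ε)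
      -- This choice makes the primitive satisfy three conditions at once: it lies in `A[t, dt]_ε`,
      -- in the kernel and in the filtration step.
      (fun n => A.pow ⌈(n : ℝ) * ε⌉₊ ⊓ (U ⊓ A.pow k))
      (fun n a ha => ⟨mem_pow_zero_mul ε a, ha.2⟩)
      (fun n a ha => ⟨A.sgn_mem_pow ha.1, hU.sgn_mem ha.2.1, A.sgn_mem_pow ha.2.2⟩)
      (fun n => inf_le_left) s (x := x)
      (fun n => ⟨pathSnd_mem x n, hxU.2 n, hx.2.2 n⟩) hxs hd
    have hz : ∀ n, pathSnd y n = 0 := fun n => by rw [hy2, Finsupp.zero_apply]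
    refine ⟨y, ⟨(hker y).mpr ⟨⟨fun n => (hy1 n).2.1, fun n => ?_⟩, hys⟩,
      fun n => (hy1 n).2.2, fun n => ?_⟩, hyx⟩
    · rw [hz]; exact zero_mem _
    · rw [hz]; exact zero_mem _
  · rw [eq_bot_iff]
    rintro x ⟨-, hx⟩
    rw [hN] at hx
    exact path_ext (Finsupp.ext hx.1) (Finsupp.ext hx.2)

/-- The evaluations `A[t, dt]_ε ⟶ A`. -/
theorem isAcyclicTower_pathEval (A : NilDGA K) {ε : ℝ} (hε : 0 < ε) (s : K) :
    IsAcyclicTower (A.pathEval ε hε s) := by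
  refine .of_path s A.isDGIdeal_top _ (fun a => ⟨pathConst A ε hε a, DGAlg.pathEval_const s a⟩)
    fun x => ?_
  exact ⟨fun h => ⟨⟨fun _ => trivial, fun _ => trivial⟩, h⟩, fun h => h.2⟩

/-- The morphism `A[t, dt]_ε ⟶ C[t, dt]_ε ×_C A`. -/
def pathLift {A C : NilDGA K} (α : A ⟶ C) {ε : ℝ} (hε : 0 < ε) (s : K) :
    A.path ε hε ⟶ fiber (C.pathEval ε hε s) α :=
  fiberLift _ _ (pathMap α ε hε) (A.pathEval ε hε s) (pathMap_eval α ε hε s)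

/-- The kernel consists of the forms with coefficients in `ker α` that vanish at `s`. Applied to a
predeformation functor, this lifts a homotopy in `C` with one end prescribed in `A`. -/
theorem isAcyclicTower_pathLift {A C : NilDGA K} (α : A ⟶ C) (hα : Function.Surjective α) {ε : ℝ}
    (hε : 0 < ε) (s : K) : IsAcyclicTower (pathLift α hε s) := by
  refine .of_path s (DGAlg.Hom.isDGIdeal_ker α) _ (fun z => ?_) fun x => ?_
  · obtain ⟨(x : (A.path ε hε).carrier), hx⟩ := DGAlg.Hom.path_surjective α hα ε (fiberFst _ _ z)
    let a := fiberSnd (C.pathEval ε hε s) α z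
    have hza : C.pathEval ε hε s (fiberFst (C.pathEval ε hε s) α z) = α a := fiber_comm z
    -- Any lift `x` of the path has a value at `s` which differs from `a` by an element of `ker α`;
    -- adding this constant corrects the value without changing the image.
    let j := a - A.pathEval ε hε s x
    have hj : α j = 0 := by
      have h1 := DGAlg.Hom.pathEval_path α (ε := ε) s x
      rw [hx] at h1
      rw [map_sub, sub_eq_zero, ← hza]
      exact h1
    have hj' : pathMap α ε hε (pathConst A ε hε j) = 0 := by
      refine (DGAlg.Hom.path_eq_zero α _).mpr ⟨fun n => ?_, fun n => zero_mem _⟩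
      rw [DGAlg.Hom.mem_ker]
      change α ((Finsupp.single 0 j : ℕ →₀ A.carrier) n) = 0
      rw [Finsupp.single_apply]
      split_ifs
      exacts [hj, map_zero _]
    refine ⟨x + pathConst A ε hε j, fiber_ext ?_ ?_⟩
    · change pathMap α ε hε (x + pathConst A ε hε j) = _
      rw [map_add, hj', add_zero]
      exact hx
    · change A.pathEval ε hε s (x + pathConst A ε hε j) = a
      rw [map_add]
      exact (congrArg (_ + ·) (DGAlg.pathEval_const s j)).trans (add_sub_cancel _ a)
  · constructor
    · intro h
      exact ⟨(DGAlg.Hom.path_eq_zero α x).mp (congrArg (fiberFst _ _) h),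
        congrArg (fiberSnd _ _) h⟩
    · rintro ⟨h1, h2⟩
      exact fiber_ext ((DGAlg.Hom.path_eq_zero α x).mpr h1) h2

/-- The product of two algebras. -/
def prod (A B : NilDGA K) : NilDGA K :=
  fiber (A := A) (B := B) (C := zero K) (DGAlg.Hom.zero A.toDGAlg (zero K).toDGAlg)
    (DGAlg.Hom.zero B.toDGAlg (zero K).toDGAlg)

/-- The morphism to a product given by a pair of morphisms. -/
def prodLift {A B X : NilDGA K} (f : X ⟶ A) (g : X ⟶ B) : X ⟶ prod A B :=
  fiberLift (C := zero K) _ _ f g (hom_ext fun _ => rfl)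

/-- The algebra of the pairs `(w, b)` of a path `w` in `A` and an element `b` of `B` such that `b`
and the origin of `w` have the same image in `C`. -/
def mappingPath {A B C : NilDGA K} (α : A ⟶ C) (β : B ⟶ C) : NilDGA K :=
  fiber (A.pathEval 1 one_pos 0 ≫ α) β

/-- The morphism which sends `(w, b)` to the end of `w` and `b`. -/
def mappingPathEnd {A B C : NilDGA K} (α : A ⟶ C) (β : B ⟶ C) : mappingPath α β ⟶ prod A B :=
  prodLift (X := mappingPath α β)
    (fiberFst (A.pathEval 1 one_pos 0 ≫ α) β ≫ A.pathEval 1 one_pos 1)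
    (fiberSnd (A.pathEval 1 one_pos 0 ≫ α) β)

/-- The kernel consists of the paths `w` with `w(1) = 0` and `α (w(0)) = 0`. Integration from `1`
gives primitives satisfying the first condition; the acyclicity and zero multiplication of `C`
restore the second. -/
theorem isAcyclicTower_mappingPathEnd {A B C : NilDGA K} (α : A ⟶ C) (β : B ⟶ C)
    (hα : Function.Surjective α) (hC : C.IsAcyclicComplex) :
    IsAcyclicTower (mappingPathEnd α β) := by
  have hα2 : ∀ k, ∀ a ∈ A.pow (k + 2), α a = 0 := by
    intro k a ha
    have h := DGAlg.Hom.map_pow α ha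
    have h2 : C.pow (k + 2) = ⊥ := by
      rw [eq_bot_iff]
      refine Submodule.span_le.mpr ?_
      rintro _ ⟨x, -, y, rfl⟩
      exact hC.1 x y
    rwa [h2] at h
  let π : mappingPath α β ⟶ A.path 1 one_pos := fiberFst _ _
  let ρ : mappingPath α β ⟶ B := fiberSnd _ _
  have hker : ∀ x, mappingPathEnd α β x = 0 ↔ A.pathEval 1 one_pos 1 (π x) = 0 ∧ ρ x = 0 :=
    fun x => ⟨fun h => ⟨congrArg (fiberFst _ _) h, congrArg (fiberSnd _ _) h⟩,
      fun h => fiber_ext h.1 h.2⟩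
  have hcomm : ∀ x, α (A.pathEval 1 one_pos 0 (π x)) = β (ρ x) := fun x => x.2
  obtain ⟨N, hN⟩ := A.nilpotent
  refine .of_filtration N _ (fun z => ?_)
    -- The exponent starts at `1`, still giving the whole kernel since `A ^ 1 = A`. From `k = 1` on,
    -- the coefficients lie in `A ^ 2`, which `α` kills.
    (fun k => DGAlg.Hom.ker (mappingPathEnd α β) ⊓
      (coeffs 1 (A.pow (k + 1))).comap
        (π.toNonUnitalAlgHom : (mappingPath α β).carrier →ₗ[K] (A.path 1 one_pos).carrier))
    (fun k => (DGAlg.Hom.isDGIdeal_ker _).inf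
      ((isDGIdeal_coeffs (A.isDGIdeal_pow (k + 1))).comap π))
    (fun x => ⟨fun h => h.1, fun h => ⟨h, fun _ => Submodule.mem_top, fun _ => Submodule.mem_top⟩⟩)
    (fun k l hkl x hx => ⟨hx.1,
      coeffs_mono (A.pow_antitone (Nat.add_le_add_right hkl 1)) hx.2⟩)
    (fun k a x hx => ⟨(DGAlg.Hom.isDGIdeal_ker _).mul_mem a x hx.1, ?_⟩)
    (fun k x hx hd => ?_) ?_
  · let a : A.carrier := fiberFst _ _ z
    let b : B.carrier := fiberSnd _ _ z
    obtain ⟨c, hc⟩ := hα (β b)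
    -- A straight path to `a` from a point `c` over `β b`.
    refine ⟨fiberMk (pathLinear c (a - c)) b ?_, fiber_ext ?_ ?_⟩
    · refine (congrArg α (pathEval_linear 0 c (a - c))).trans ?_
      rw [zero_smul, add_zero, hc]
    · refine (pathEval_linear 1 c (a - c)).trans ?_
      rw [one_smul, add_sub_cancel]
      rfl
    · rfl
  · change π (a * x) ∈ coeffs (A := A.toDGAlg) 1 (A.pow (k + 2))
    rw [map_mul]
    exact mul_mem_coeffs (fun _ => A.sgn_mem_pow) (fun a _ h => A.mul_mem_pow_succ' a h) _ hx.2
  · obtain ⟨hx1, hx2⟩ := (hker x).mp hx.1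
    have hπd : (A.path 1 one_pos).d (π x) = 0 := by
      rw [← DGAlg.Hom.map_d, hd, map_zero]
    obtain ⟨(y : (A.path 1 one_pos).carrier), hy1, hy2, hys, hyx⟩ :=
        exists_d_eq_of_eval_eq_zero (A := A.toDGAlg) (ε := 1)
      (fun n => A.pow ⌈(n : ℝ) * 1⌉₊ ⊓ A.pow (k + 1))
      (fun n a ha => ⟨mem_pow_zero_mul 1 a, ha.2⟩)
      (fun n a ha => ⟨A.sgn_mem_pow ha.1, A.sgn_mem_pow ha.2⟩)
      (fun n => inf_le_left) 1 (x := π x)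
      (fun n => ⟨pathSnd_mem (A := A.toDGAlg) (π x) n, hx.2.2 n⟩) hx1 hπd
    have hyc : y ∈ coeffs 1 (A.pow (k + 1)) :=
      ⟨fun n => (hy1 n).2, fun n => by rw [hy2]; exact zero_mem _⟩
    suffices ∃ y' ∈ coeffs (A := A.toDGAlg) 1 (A.pow (k + 1)), A.pathEval 1 one_pos 1 y' = 0 ∧
        α (A.pathEval 1 one_pos 0 y') = 0 ∧ (A.path 1 one_pos).d y' = π x by
      obtain ⟨y', h1, h2, h3, h4⟩ := this
      refine ⟨fiberMk y' 0 (h3.trans (map_zero _).symm), ⟨(hker _).mpr ⟨h2, rfl⟩, h1⟩,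
        fiber_ext h4 ?_⟩
      exact (map_zero B.d).trans hx2.symm
    -- The primitive `y` may fail to satisfy `α (y(0)) = 0` only for `k = 0`. There `α (y(0))` is a
    -- cocycle, equal to `d (α a)` for some `a`, and subtracting `d (a (1 - t))` changes neither `d
    -- y` nor the value at `1`.
    rcases k with _ | k
    · have h0 : C.d (α (A.pathEval 1 one_pos 0 y)) = 0 := by
        rw [← DGAlg.Hom.map_d, ← DGAlg.Hom.map_d]
        refine (congrArg (fun z => α (A.pathEval 1 one_pos 0 z)) hyx).trans ?_
        rw [hcomm, hx2, map_zero]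
      obtain ⟨c, hc⟩ := hC.2 _ h0
      obtain ⟨a, rfl⟩ := hα c
      let l : (A.path 1 one_pos).carrier := pathLinear a (-a)
      refine ⟨y - (A.path 1 one_pos).d l,
        ⟨fun _ => Submodule.mem_top, fun _ => Submodule.mem_top⟩, ?_, ?_, ?_⟩
      · rw [map_sub, DGAlg.Hom.map_d]
        refine (congrArg₂ (fun u v => u - A.d v) hys (pathEval_linear 1 a (-a))).trans ?_
        simp
      · rw [map_sub, DGAlg.Hom.map_d]
        refine (congrArg (fun v => α (_ - A.d v)) (pathEval_linear 0 a (-a))).trans ?_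
        rw [zero_smul, add_zero, map_sub, DGAlg.Hom.map_d, hc, sub_self]
      · rw [map_sub, DGAlg.d_d, sub_zero]
        exact hyx
    · exact ⟨y, hyc, hys, hα2 k _ (polyEval_mem_submodule 0 hyc.1), hyx⟩
  · rw [eq_bot_iff]
    rintro x ⟨hx1, hx2⟩
    have h3 : A.pow (N + 1) = ⊥ := eq_bot_iff.mpr ((A.pow_succ_le N).trans hN.le)
    rw [h3] at hx2
    exact fiber_ext (path_ext (Finsupp.ext hx2.1) (Finsupp.ext hx2.2)) ((hker x).mp hx1).2

/-- A kernel element is a path with coefficients in `I = ker p` that vanishes at both ends. It is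
annihilated because `A I = 0`, and a primitive from `0` can be made to vanish at `1` because `I` is
acyclic. -/
theorem isAcyclicSmallExtension_relativePathEnds {A B : NilDGA K} {p : A ⟶ B}
    (hp : IsAcyclicSmallExtension p) : IsAcyclicSmallExtension (relativePathEnds p) := by
  let ρ : relativePath p ⟶ B := fiberSnd _ _
  have hker : ∀ x, relativePathEnds p x = 0 ↔ A.pathEval 1 one_pos 0 (relativePathIncl p x) = 0 ∧
      A.pathEval 1 one_pos 1 (relativePathIncl p x) = 0 :=
    fun x => ⟨fun h => ⟨congrArg (fiberFst _ _) h, congrArg (fiberSnd _ _) h⟩,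
      fun h => fiber_ext h.1 h.2⟩
  have hcomm : ∀ x, pathMap p 1 one_pos (relativePathIncl p x) = pathConst B 1 one_pos (ρ x) :=
    fun x => x.2
  have hρ : ∀ x, relativePathEnds p x = 0 → ρ x = 0 := fun x hx => by
    have h : p (A.pathEval 1 one_pos 0 (relativePathIncl p x)) = ρ x :=
      congrArg (fun k : relativePath p ⟶ B => k x) (relativePath_condition p 0)
    rw [← h, ((hker x).mp hx).1, map_zero]
  have hcoef : ∀ x, relativePathEnds p x = 0 →
      relativePathIncl p x ∈ coeffs (A := A.toDGAlg) 1 (DGAlg.Hom.ker p) := fun x hx => by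
    refine (DGAlg.Hom.path_eq_zero p _).mp ((hcomm x).trans ?_)
    rw [hρ x hx, map_zero]
    rfl
  refine ⟨fun z => ?_, fun a x hx => ?_, fun x hx hd => ?_⟩
  · let a : A.carrier := fiberFst _ _ z
    let a' : A.carrier := fiberSnd _ _ z
    have haa' : p a = p a' := fiber_comm z
    -- The straight path from `a` to `a'` has constant image because `a' - a ∈ ker p`.
    refine ⟨fiberMk (pathLinear a (a' - a)) (p a) (path_ext ?_ ?_), fiber_ext ?_ ?_⟩
    · change DGAlg.Hom.polyMap p (Finsupp.single 0 a + Finsupp.single 1 (a' - a)) =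
        Finsupp.single 0 (p a)
      rw [map_add]
      have h0 : p (a' - a) = 0 := by rw [map_sub, haa', sub_self]
      simp only [DGAlg.Hom.polyMap, Finsupp.mapRange.linearMap_apply, Finsupp.mapRange_single]
      change Finsupp.single 0 (p a) + Finsupp.single 1 (p (a' - a)) = _
      rw [h0, Finsupp.single_zero, add_zero]
    · exact map_zero (DGAlg.Hom.polyMap p)
    · refine (pathEval_linear 0 a (a' - a)).trans ?_
      rw [zero_smul, add_zero]
      rfl
    · refine (pathEval_linear 1 a (a' - a)).trans ?_
      rw [one_smul, add_sub_cancel]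
      rfl
  · refine fiber_ext ?_ ?_
    · have h1 : relativePathIncl p (a * x) ∈ coeffs (A := A.toDGAlg) 1 ⊥ := by
        rw [map_mul]
        refine mul_mem_coeffs (fun _ h => (DGAlg.Hom.isDGIdeal_ker p).sgn_mem h)
          (fun b y hy => ?_) _ (hcoef x hx)
        exact hp.small b y hy
      exact path_ext (Finsupp.ext h1.1) (Finsupp.ext h1.2)
    · change ρ (a * x) = 0
      rw [map_mul, hρ x hx, mul_zero]
  · obtain ⟨hx0, hx1⟩ := (hker x).mp hx
    have hπd : (A.path 1 one_pos).d (relativePathIncl p x) = 0 := by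
      rw [← DGAlg.Hom.map_d, hd, map_zero]
    obtain ⟨(y : (A.path 1 one_pos).carrier), hy1, hy2, hys, hyx⟩ :=
        exists_d_eq_of_eval_eq_zero (A := A.toDGAlg) (ε := 1)
      (fun n => A.pow ⌈(n : ℝ) * 1⌉₊ ⊓ DGAlg.Hom.ker p)
      (fun n a ha => ⟨mem_pow_zero_mul 1 a, ha.2⟩)
      (fun n a ha => ⟨A.sgn_mem_pow ha.1, (DGAlg.Hom.isDGIdeal_ker p).sgn_mem ha.2⟩)
      (fun n => inf_le_left) 0 (x := relativePathIncl p x)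
      (fun n => ⟨pathSnd_mem (A := A.toDGAlg) (relativePathIncl p x) n, (hcoef x hx).2 n⟩) hx0 hπd
    have hyc : y ∈ coeffs 1 (DGAlg.Hom.ker p) :=
      ⟨fun n => (hy1 n).2, fun n => by rw [hy2]; exact zero_mem _⟩
    have hi : p (A.pathEval 1 one_pos 1 y) = 0 :=
      polyEval_mem_submodule (V := DGAlg.Hom.ker p) 1 hyc.1
    have hdi : A.d (A.pathEval 1 one_pos 1 y) = 0 := by
      rw [← DGAlg.Hom.map_d]
      exact (congrArg (A.pathEval 1 one_pos 1) hyx).trans hx1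
    obtain ⟨j, hj, hji⟩ := hp.acyclic _ hi hdi
    let l : (A.path 1 one_pos).carrier := pathLinear 0 j
    -- The end `y(1)` is a cocycle of `ker p`, hence `d j`; subtracting `d (j t)` kills it and keeps
    -- `y(0) = 0`.
    let y' : (A.path 1 one_pos).carrier := y - (A.path 1 one_pos).d l
    have hy'c : y' ∈ coeffs (A := A.toDGAlg) 1 (DGAlg.Hom.ker p) :=
      sub_mem (S := Submodule K (A.path 1 one_pos).carrier) hyc
        ((isDGIdeal_coeffs (DGAlg.Hom.isDGIdeal_ker p)).d_mem _
          (pathLinear_mem_coeffs (zero_mem _) hj))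
    refine ⟨fiberMk y' 0 ?_, (hker _).mpr ⟨?_, ?_⟩, fiber_ext ?_ ?_⟩
    · exact ((DGAlg.Hom.path_eq_zero p y').mpr hy'c).trans (map_zero _).symm
    · change A.pathEval 1 one_pos 0 (y - (A.path 1 one_pos).d l) = 0
      rw [map_sub, DGAlg.Hom.map_d]
      refine (congrArg₂ (fun u v => u - A.d v) hys (pathEval_linear 0 0 j)).trans ?_
      simp
    · change A.pathEval 1 one_pos 1 (y - (A.path 1 one_pos).d l) = 0
      rw [map_sub, DGAlg.Hom.map_d]
      refine (congrArg (fun v => _ - A.d v) (pathEval_linear 1 0 j)).trans ?_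
      rw [one_smul, zero_add, hji, sub_self]
    · change (A.path 1 one_pos).d (y - (A.path 1 one_pos).d l) = _
      rw [map_sub, DGAlg.d_d, sub_zero]
      exact hyx
    · exact (map_zero B.d).trans (hρ x hx).symm

end NilDGA

/-! ### Orthogonality of paths and constants -/

namespace DGAlg

variable {K : Type u} [Field K] {A B P : DGAlg K} {ε : ℝ}

/-- This orthogonality makes the sum of the two maps multiplicative in `prodPathFst`. -/
theorem path_mul_const {f : Hom A P} {g : Hom B P} (h₁ : ∀ a b, f a * g b = 0)
    (h₂ : ∀ a b, g b * f a = 0) (x : A.path ε) (b : B) :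
    f.path ε x * P.pathConst ε (g b) = 0 ∧ P.pathConst ε (g b) * f.path ε x = 0 := by
  have h₃ : ∀ (p : ℕ →₀ A) (b : B), P.polyMul (f.polyMap p) (Finsupp.single 0 (g b)) = 0 := by
    intro p b
    induction p using Finsupp.induction_linear with
    | zero => simp
    | add p q hp hq => rw [map_add, map_add, LinearMap.add_apply, hp, hq, add_zero]
    | single n a =>
      rw [Hom.polyMap, Finsupp.mapRange.linearMap_apply, Finsupp.mapRange_single, polyMul_single]
      exact (congrArg _ (h₁ a b)).trans (Finsupp.single_zero _)
  have h₄ : ∀ (p : ℕ →₀ A) (b : B), P.polyMul (Finsupp.single 0 (g b)) (f.polyMap p) = 0 := by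
    intro p b
    induction p using Finsupp.induction_linear with
    | zero => simp
    | add p q hp hq => rw [map_add, map_add, hp, hq, add_zero]
    | single n a =>
      rw [Hom.polyMap, Finsupp.mapRange.linearMap_apply, Finsupp.mapRange_single, polyMul_single]
      exact (congrArg _ (h₂ a b)).trans (Finsupp.single_zero _)
  refine ⟨path_ext (h₃ _ b) ?_, path_ext (h₄ _ b) ?_⟩
  · rw [pathSnd_mul, pathSnd_const, pathFst_const, map_zero, polyMap_single, ← g.map_sgn, zero_add]
    exact h₃ (pathSnd x) _
  · rw [pathSnd_mul, pathSnd_const, pathFst_const, map_zero, LinearMap.zero_apply, add_zero]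
    exact h₄ (pathSnd x) b

end DGAlg

/-! ### The quotient by homotopy -/

namespace NilDGA

variable {K : Type u} [Field K] {F : NilDGA K ⥤ Type w}

theorem Homotopic.map {A B : NilDGA K} (f : A ⟶ B) {a b : F.obj A} (h : Homotopic F A a b) :
    Homotopic F B (F.map f a) (F.map f b) := by
  obtain ⟨ε, hε, x, rfl, rfl⟩ := h
  refine ⟨ε, hε, F.map (pathMap f ε hε) x, ?_, ?_⟩
  all_goals rw [← Functor.map_comp_apply, ← Functor.map_comp_apply, pathMap_eval]

theorem Homotopic.app {F G : NilDGA K ⥤ Type w} (φ : F ⟶ G) {A : NilDGA K} {a b : F.obj A}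
    (h : Homotopic F A a b) : Homotopic G A (φ.app A a) (φ.app A b) := by
  obtain ⟨ε, hε, x, rfl, rfl⟩ := h
  exact ⟨ε, hε, φ.app _ x, (NatTrans.naturality_apply φ _ x).symm,
    (NatTrans.naturality_apply φ _ x).symm⟩

theorem eqvGen_map {A B : NilDGA K} (f : A ⟶ B) {a b : F.obj A}
    (h : Relation.EqvGen (Homotopic F A) a b) :
    Relation.EqvGen (Homotopic F B) (F.map f a) (F.map f b) := by
  induction h with
  | rel a b h => exact .rel _ _ (h.map f)
  | refl a => exact .refl _
  | symm a b _ ih => exact .symm _ _ ih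
  | trans a b c _ _ ih₁ ih₂ => exact .trans _ _ _ ih₁ ih₂

/-- The quotient of a functor by homotopy. -/
def homotopyQuot (F : NilDGA K ⥤ Type w) : NilDGA K ⥤ Type w where
  obj A := Quot (Homotopic F A)
  map f := ↾(Quot.map (F.map f) fun _ _ h => h.map f)
  map_id A := by
    ext ⟨a⟩
    exact congrArg (Quot.mk _) (Functor.map_id_apply F A a)
  map_comp f g := by
    ext ⟨a⟩
    exact congrArg (Quot.mk _) (Functor.map_comp_apply F f g a)

/-- The quotient map. -/
def toHomotopyQuot (F : NilDGA K ⥤ Type w) : F ⟶ homotopyQuot F where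
  app A := ↾(Quot.mk (Homotopic F A))
  naturality _ _ _ := rfl

theorem toHomotopyQuot_surjective (A : NilDGA K) :
    Function.Surjective ((toHomotopyQuot F).app A) := Quot.mk_surjective

/-- `Quot` by an arbitrary relation identifies exactly the pairs in the generated equivalence, so no
transitivity of homotopy is needed. -/
theorem toHomotopyQuot_eq_iff {A : NilDGA K} {a b : F.obj A} :
    (toHomotopyQuot F).app A a = (toHomotopyQuot F).app A b ↔
      Relation.EqvGen (Homotopic F A) a b := Quot.eq

theorem homotopyQuot_map {A B : NilDGA K} (f : A ⟶ B) (a : F.obj A) :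
    (homotopyQuot F).map f ((toHomotopyQuot F).app A a) =
      (toHomotopyQuot F).app B (F.map f a) := rfl

/-! ### Homotopy in products -/

/-- The inclusion of the first factor of a product. -/
def prodInl (A B : NilDGA K) : A ⟶ prod A B :=
  prodLift (𝟙 A) (DGAlg.Hom.zero A.toDGAlg B.toDGAlg)

/-- The inclusion of the second factor of a product. -/
def prodInr (A B : NilDGA K) : B ⟶ prod A B :=
  prodLift (DGAlg.Hom.zero B.toDGAlg A.toDGAlg) (𝟙 B)

theorem prodInl_mul_prodInr (A B : NilDGA K) (a : A.carrier) (b : B.carrier) :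
    prodInl A B a * prodInr A B b = 0 :=
  DGAlg.fiber_ext (mul_zero a) (zero_mul b)

theorem prodInr_mul_prodInl (A B : NilDGA K) (a : A.carrier) (b : B.carrier) :
    prodInr A B b * prodInl A B a = 0 :=
  DGAlg.fiber_ext (zero_mul a) (mul_zero b)

/-- The projection `A × B ⟶ A`. -/
def prodFst (A B : NilDGA K) : prod A B ⟶ A := fiberFst _ _

/-- The projection `A × B ⟶ B`. -/
def prodSnd (A B : NilDGA K) : prod A B ⟶ B := fiberSnd _ _

/-- The morphism `A[t, dt]_ε × B ⟶ (A × B)[t, dt]_ε` which sends `(w, b)` to the path with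
components `w` and the constant path `b`. -/
def prodPathFst (A B : NilDGA K) (ε : ℝ) (hε : 0 < ε) :
    prod (A.path ε hε) B ⟶ (prod A B).path ε hε :=
  DGAlg.Hom.add (X := (prod (A.path ε hε) B).toDGAlg) (A := ((prod A B).path ε hε).toDGAlg)
    (prodFst (A.path ε hε) B ≫ pathMap (prodInl A B) ε hε)
    (prodSnd (A.path ε hε) B ≫ prodInr A B ≫ pathConst (prod A B) ε hε)
    (fun _ _ => (DGAlg.path_mul_const (prodInl_mul_prodInr A B) (prodInr_mul_prodInl A B) _ _).1)
    (fun _ _ => (DGAlg.path_mul_const (prodInl_mul_prodInr A B) (prodInr_mul_prodInl A B) _ _).2)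

theorem prodPathFst_eval (A B : NilDGA K) (ε : ℝ) (hε : 0 < ε) (s : K) :
    prodPathFst A B ε hε ≫ (prod A B).pathEval ε hε s =
      prodLift (prodFst (A.path ε hε) B ≫ A.pathEval ε hε s) (prodSnd (A.path ε hε) B) := by
  refine hom_ext fun x => ?_
  have h : (prod A B).pathEval ε hε s (prodPathFst A B ε hε x) =
      prodInl A B (A.pathEval ε hε s (prodFst (A.path ε hε) B x)) +
        prodInr A B (prodSnd (A.path ε hε) B x) :=
    (map_add ((prod A B).pathEval ε hε s).toNonUnitalAlgHom _ _).trans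
      (congrArg₂ (· + ·) (DGAlg.Hom.pathEval_path (prodInl A B) s _) (DGAlg.pathEval_const s _))
  refine h.trans (DGAlg.fiber_ext ?_ ?_)
  · exact add_zero (A.pathEval ε hε s (prodFst (A.path ε hε) B x))
  · exact zero_add (prodSnd (A.path ε hε) B x)

theorem prodLift_fst {A B X : NilDGA K} (f : X ⟶ A) (g : X ⟶ B) :
    prodLift f g ≫ prodFst A B = f := rfl

theorem prodLift_snd {A B X : NilDGA K} (f : X ⟶ A) (g : X ⟶ B) :
    prodLift f g ≫ prodSnd A B = g := rfl

theorem isAcyclicComplex_zero : (zero K).IsAcyclicComplex :=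
  ⟨fun _ _ => rfl, fun _ _ => ⟨0, rfl⟩⟩

/-- The product is the fibre product over the zero algebra, which is acyclic with zero
multiplication. -/
theorem IsPredeformation.prod_ext (hF : IsPredeformation F) {A B : NilDGA K}
    {x y : F.obj (prod A B)} (h₁ : F.map (prodFst A B) x = F.map (prodFst A B) y)
    (h₂ : F.map (prodSnd A B) x = F.map (prodSnd A B) y) : x = y :=
  (hF.fiber_bijective (A := A) (B := B) (C := NilDGA.zero K)
    (DGAlg.Hom.zero A.toDGAlg (NilDGA.zero K).toDGAlg) (DGAlg.Hom.zero B.toDGAlg (NilDGA.zero K).toDGAlg) (fun _ => ⟨0, rfl⟩)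
    isAcyclicComplex_zero).1 (Subtype.ext (Prod.ext h₁ h₂))

theorem IsPredeformation.exists_prod (hF : IsPredeformation F) {A B : NilDGA K} (a : F.obj A)
    (b : F.obj B) : ∃ x : F.obj (prod A B), F.map (prodFst A B) x = a ∧
      F.map (prodSnd A B) x = b := by
  obtain ⟨_⟩ := hF.zero
  obtain ⟨x, hx⟩ := hF.fiber_surjective (A := A) (B := B) (C := NilDGA.zero K)
    (DGAlg.Hom.zero A.toDGAlg (NilDGA.zero K).toDGAlg) (DGAlg.Hom.zero B.toDGAlg (NilDGA.zero K).toDGAlg)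
    (fun _ => ⟨0, rfl⟩) ⟨(a, b), Subsingleton.elim _ _⟩
  exact ⟨x, congrArg (fun z => z.1.1) hx, congrArg (fun z => z.1.2) hx⟩

/-- A homotopy in the first coordinate is paired with a constant path in the second through
`prodPathFst`. The quantification over `x` and `y` lets the induction insert intermediate points of
a chain. -/
theorem IsPredeformation.eqvGen_prod_fst (hF : IsPredeformation F) {A B : NilDGA K} {a a' : F.obj A}
    (h : Relation.EqvGen (Homotopic F A) a a') : ∀ x y : F.obj (prod A B),
      F.map (prodFst A B) x = a → F.map (prodFst A B) y = a' →
      F.map (prodSnd A B) x = F.map (prodSnd A B) y →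
      Relation.EqvGen (Homotopic F (prod A B)) x y := by
  induction h with
  | rel a a' h =>
    obtain ⟨ε, hε, w, rfl, rfl⟩ := h
    intro x y hx hy hxy
    obtain ⟨z, hz₁, hz₂⟩ := hF.exists_prod w (F.map (prodSnd A B) x)
    refine .rel _ _ ⟨ε, hε, F.map (prodPathFst A B ε hε) z, ?_, ?_⟩
    · rw [← Functor.map_comp_apply, prodPathFst_eval]
      refine hF.prod_ext ?_ ?_
      · rw [← Functor.map_comp_apply, prodLift_fst, Functor.map_comp_apply, hz₁, hx]
      · rw [← Functor.map_comp_apply, prodLift_snd, hz₂]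
    · rw [← Functor.map_comp_apply, prodPathFst_eval]
      refine hF.prod_ext ?_ ?_
      · rw [← Functor.map_comp_apply, prodLift_fst, Functor.map_comp_apply, hz₁, hy]
      · rw [← Functor.map_comp_apply, prodLift_snd, hz₂, hxy]
  | refl a =>
    intro x y hx hy hxy
    rw [hF.prod_ext (hx.trans hy.symm) hxy]
    exact .refl _
  | symm a a' _ ih => exact fun x y hx hy hxy => .symm _ _ (ih y x hy hx hxy.symm)
  | trans a₁ a₂ a₃ _ _ ih₁ ih₂ =>
    intro x y hx hy hxy
    obtain ⟨z, hz₁, hz₂⟩ := hF.exists_prod a₂ (F.map (prodSnd A B) x)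
    exact .trans _ _ _ (ih₁ x z hx hz₁ hz₂.symm) (ih₂ z y hz₁ hy (hz₂.trans hxy))

/-- The exchange of the factors of a product. -/
def prodSwap (A B : NilDGA K) : prod A B ⟶ prod B A := prodLift (prodSnd A B) (prodFst A B)

theorem prodSwap_fst (A B : NilDGA K) : prodSwap A B ≫ prodFst B A = prodSnd A B := rfl

theorem prodSwap_snd (A B : NilDGA K) : prodSwap A B ≫ prodSnd B A = prodFst A B := rfl

theorem prodSwap_swap (A B : NilDGA K) : prodSwap A B ≫ prodSwap B A = 𝟙 (prod A B) := rfl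

theorem IsPredeformation.eqvGen_prod_snd (hF : IsPredeformation F) {A B : NilDGA K}
    {x y : F.obj (prod A B)} (h₁ : F.map (prodFst A B) x = F.map (prodFst A B) y)
    (h₂ : Relation.EqvGen (Homotopic F B) (F.map (prodSnd A B) x) (F.map (prodSnd A B) y)) :
    Relation.EqvGen (Homotopic F (prod A B)) x y := by
  have h := hF.eqvGen_prod_fst h₂ (F.map (prodSwap A B) x) (F.map (prodSwap A B) y)
    (by rw [← Functor.map_comp_apply, prodSwap_fst]) (by rw [← Functor.map_comp_apply, prodSwap_fst])
    (by rw [← Functor.map_comp_apply, ← Functor.map_comp_apply, prodSwap_snd, h₁])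
  have h' := eqvGen_map (prodSwap B A) h
  rwa [← Functor.map_comp_apply, ← Functor.map_comp_apply, prodSwap_swap, Functor.map_id_apply,
    Functor.map_id_apply] at h'

theorem IsPredeformation.eqvGen_prod (hF : IsPredeformation F) {A B : NilDGA K}
    {x y : F.obj (prod A B)}
    (h₁ : Relation.EqvGen (Homotopic F A) (F.map (prodFst A B) x) (F.map (prodFst A B) y))
    (h₂ : Relation.EqvGen (Homotopic F B) (F.map (prodSnd A B) x) (F.map (prodSnd A B) y)) :
    Relation.EqvGen (Homotopic F (prod A B)) x y := by
  -- The chains in the two coordinates may have different lengths, so one coordinate is moved at a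
  -- time.
  obtain ⟨z, hz₁, hz₂⟩ := hF.exists_prod (F.map (prodFst A B) y) (F.map (prodSnd A B) x)
  refine .trans _ z _ (hF.eqvGen_prod_fst h₁ x z rfl hz₁ hz₂.symm) (hF.eqvGen_prod_snd hz₁ ?_)
  rwa [hz₂]

/-! ### Factorisation of `A ×_C B → A × B` through paths -/

/-- The constant paths. -/
def mappingPathConst {A B C : NilDGA K} (α : A ⟶ C) (β : B ⟶ C) : fiber α β ⟶ mappingPath α β :=
  fiberLift _ _ (fiberFst α β ≫ pathConst A 1 one_pos) (fiberSnd α β) (by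
    rw [Category.assoc, ← Category.assoc (pathConst A 1 one_pos), pathConst_eval, Category.id_comp,
      fiber_condition])

/-- The origins of the paths. -/
def mappingPathOrigin {A B C : NilDGA K} (α : A ⟶ C) (β : B ⟶ C) : mappingPath α β ⟶ fiber α β :=
  fiberLift (X := mappingPath α β) α β
    (fiberFst (A.pathEval 1 one_pos 0 ≫ α) β ≫ A.pathEval 1 one_pos 0)
    (fiberSnd (A.pathEval 1 one_pos 0 ≫ α) β) (fiber_condition _ _)

theorem mappingPathConst_origin {A B C : NilDGA K} (α : A ⟶ C) (β : B ⟶ C) :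
    mappingPathConst α β ≫ mappingPathOrigin α β = 𝟙 (fiber α β) :=
  hom_ext fun _ => DGAlg.fiber_ext (DGAlg.pathEval_const 0 _) rfl

theorem mappingPathConst_end {A B C : NilDGA K} (α : A ⟶ C) (β : B ⟶ C) :
    mappingPathConst α β ≫ mappingPathEnd α β = prodLift (fiberFst α β) (fiberSnd α β) :=
  hom_ext fun _ => DGAlg.fiber_ext (DGAlg.pathEval_const 1 _) rfl

/-! ### The quotient is a deformation functor -/

variable [CharZero K]

/-- Homotopies lift along surjective morphisms. -/
theorem exists_homotopic_lift (hF : IsPredeformation F) {A C : NilDGA K} (α : A ⟶ C)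
    (hα : Function.Surjective α) {ε : ℝ} (hε : 0 < ε) (s : K) (z : F.obj (C.path ε hε))
    (a : F.obj A) (h : F.map (C.pathEval ε hε s) z = F.map α a) :
    ∃ x : F.obj (A.path ε hε), F.map (pathMap α ε hε) x = z ∧ F.map (A.pathEval ε hε s) x = a := by
  -- Evaluation serves as the surjective leg of the fibre product, the constants being a section.
  obtain ⟨y, hy⟩ := hF.fiber_surjective (C.pathEval ε hε s) α
    (fun a => ⟨pathConst C ε hε a, DGAlg.pathEval_const s a⟩) ⟨(z, a), h⟩
  obtain ⟨x, rfl⟩ := (isAcyclicTower_pathLift α hα hε s).map_surjective hF.quasismooth y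
  have hy' := congrArg Subtype.val hy
  refine ⟨x, ?_, ?_⟩
  · refine Eq.trans ?_ (congrArg Prod.fst hy')
    exact Functor.map_comp_apply F (pathLift α hε s) (fiberFst _ _) x
  · refine Eq.trans ?_ (congrArg Prod.snd hy')
    exact Functor.map_comp_apply F (pathLift α hε s) (fiberSnd _ _) x

/-- Each homotopy in the chain is lifted in turn, from its origin or from its end. Both directions
are proved together so that the induction passes through symmetry. -/
theorem exists_eqvGen_lift (hF : IsPredeformation F) {A C : NilDGA K} (α : A ⟶ C)
    (hα : Function.Surjective α) {c c' : F.obj C} (h : Relation.EqvGen (Homotopic F C) c c') :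
    (∀ a, F.map α a = c → ∃ a', Relation.EqvGen (Homotopic F A) a a' ∧ F.map α a' = c') ∧
      ∀ a, F.map α a = c' → ∃ a', Relation.EqvGen (Homotopic F A) a a' ∧ F.map α a' = c := by
  induction h with
  | rel c c' h =>
    obtain ⟨ε, hε, z, rfl, rfl⟩ := h
    constructor
    · intro a ha
      obtain ⟨x, rfl, rfl⟩ := exists_homotopic_lift hF α hα hε 0 z a ha.symm
      refine ⟨_, .rel _ _ ⟨ε, hε, x, rfl, rfl⟩, ?_⟩
      rw [← Functor.map_comp_apply, ← Functor.map_comp_apply, pathMap_eval]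
    · intro a ha
      obtain ⟨x, rfl, rfl⟩ := exists_homotopic_lift hF α hα hε 1 z a ha.symm
      refine ⟨_, .symm _ _ (.rel _ _ ⟨ε, hε, x, rfl, rfl⟩), ?_⟩
      rw [← Functor.map_comp_apply, ← Functor.map_comp_apply, pathMap_eval]
  | refl c => exact ⟨fun a ha => ⟨a, .refl a, ha⟩, fun a ha => ⟨a, .refl a, ha⟩⟩
  | symm c c' _ ih => exact ⟨ih.2, ih.1⟩
  | trans c₁ c₂ c₃ _ _ ih₁ ih₂ =>
    constructor
    · intro a ha
      obtain ⟨a', h, ha'⟩ := ih₁.1 a ha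
      obtain ⟨a'', h', ha''⟩ := ih₂.1 a' ha'
      exact ⟨a'', .trans _ _ _ h h', ha''⟩
    · intro a ha
      obtain ⟨a', h, ha'⟩ := ih₂.2 a ha
      obtain ⟨a'', h', ha''⟩ := ih₁.2 a' ha'
      exact ⟨a'', .trans _ _ _ h h', ha''⟩

/-- Two elements with the same image under an acyclic small extension are homotopic. -/
theorem homotopic_of_map_eq (hF : IsPredeformation F) {A B : NilDGA K} {p : A ⟶ B}
    (hp : IsAcyclicSmallExtension p) {a b : F.obj A} (h : F.map p a = F.map p b) :
    Homotopic F A a b := by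
  -- The pair comes from `F(A ×_B A)`, and then from a path with constant image; forgetting that
  -- constancy leaves a homotopy.
  obtain ⟨y, hy⟩ := hF.fiber_surjective p p hp.surjective ⟨(a, b), h⟩
  obtain ⟨x, rfl⟩ := hF.quasismooth _ (isAcyclicSmallExtension_relativePathEnds hp) y
  have hy' := congrArg Subtype.val hy
  refine ⟨1, one_pos, F.map (relativePathIncl p) x, ?_, ?_⟩
  · refine Eq.trans ?_ (congrArg Prod.fst hy')
    refine Eq.trans ?_ (Functor.map_comp_apply F (relativePathEnds p) (fiberFst _ _) x)
    exact (Functor.map_comp_apply F (relativePathIncl p) (A.pathEval 1 one_pos 0) x).symm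
  · refine Eq.trans ?_ (congrArg Prod.snd hy')
    refine Eq.trans ?_ (Functor.map_comp_apply F (relativePathEnds p) (fiberSnd _ _) x)
    exact (Functor.map_comp_apply F (relativePathIncl p) (A.pathEval 1 one_pos 1) x).symm

theorem homotopyQuot_map_injective (hF : IsPredeformation F) {A B : NilDGA K} (p : A ⟶ B)
    (hp : IsAcyclicSmallExtension p) : Function.Injective ((homotopyQuot F).map p) := by
  intro x y h
  obtain ⟨a, rfl⟩ := toHomotopyQuot_surjective A x
  obtain ⟨b, rfl⟩ := toHomotopyQuot_surjective A y
  rw [homotopyQuot_map, homotopyQuot_map, toHomotopyQuot_eq_iff] at h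
  -- Lifting the chain moves `a` within its class to an element with the same image as `b`.
  obtain ⟨a', haa', ha'⟩ := (exists_eqvGen_lift hF p hp.surjective h).1 a rfl
  exact toHomotopyQuot_eq_iff.mpr (.trans _ _ _ haa' (.rel _ _ (homotopic_of_map_eq hF hp ha')))

theorem homotopyQuot_fiber_surjective (hF : IsPredeformation F) {A B C : NilDGA K} (α : A ⟶ C)
    (β : B ⟶ C) (hα : Function.Surjective α) :
    Function.Surjective (fiberMap (homotopyQuot F) α β) := by
  rintro ⟨⟨x, y⟩, h⟩
  obtain ⟨a, rfl⟩ := toHomotopyQuot_surjective A x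
  obtain ⟨b, rfl⟩ := toHomotopyQuot_surjective B y
  dsimp only at h
  rw [homotopyQuot_map, homotopyQuot_map, toHomotopyQuot_eq_iff] at h
  obtain ⟨a', haa', ha'⟩ := (exists_eqvGen_lift hF α hα h).1 a rfl
  obtain ⟨z, hz⟩ := hF.fiber_surjective α β hα ⟨(a', b), ha'⟩
  have hz' := congrArg Subtype.val hz
  refine ⟨(toHomotopyQuot F).app _ z, Subtype.ext (Prod.ext ?_ ?_)⟩
  · refine (congrArg ((toHomotopyQuot F).app A) (congrArg Prod.fst hz')).trans ?_
    exact toHomotopyQuot_eq_iff.mpr (.symm _ _ haa')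
  · exact congrArg ((toHomotopyQuot F).app B) (congrArg Prod.snd hz')

/-- The two elements agree in `F⁺(A × B)`, hence as constant paths in `F⁺` of `mappingPath`, where
the end map is injective; the origin map recovers them. -/
theorem homotopyQuot_fiber_injective (hF : IsPredeformation F) {A B C : NilDGA K} (α : A ⟶ C)
    (β : B ⟶ C) (hα : Function.Surjective α) (hC : C.IsAcyclicComplex) :
    Function.Injective (fiberMap (homotopyQuot F) α β) := by
  intro x y h
  obtain ⟨a, rfl⟩ := toHomotopyQuot_surjective _ x
  obtain ⟨b, rfl⟩ := toHomotopyQuot_surjective _ y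
  have h₁ : (homotopyQuot F).map (fiberFst α β) ((toHomotopyQuot F).app _ a) =
      (homotopyQuot F).map (fiberFst α β) ((toHomotopyQuot F).app _ b) :=
    congrArg (fun z => z.1.1) h
  have h₂ : (homotopyQuot F).map (fiberSnd α β) ((toHomotopyQuot F).app _ a) =
      (homotopyQuot F).map (fiberSnd α β) ((toHomotopyQuot F).app _ b) :=
    congrArg (fun z => z.1.2) h
  rw [homotopyQuot_map, homotopyQuot_map, toHomotopyQuot_eq_iff] at h₁ h₂
  have h₃ : (homotopyQuot F).map (mappingPathConst α β ≫ mappingPathEnd α β)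
      ((toHomotopyQuot F).app _ a) =
      (homotopyQuot F).map (mappingPathConst α β ≫ mappingPathEnd α β)
        ((toHomotopyQuot F).app _ b) := by
    rw [mappingPathConst_end, homotopyQuot_map, homotopyQuot_map, toHomotopyQuot_eq_iff]
    refine hF.eqvGen_prod ?_ ?_
    · rwa [← Functor.map_comp_apply, ← Functor.map_comp_apply, prodLift_fst]
    · rwa [← Functor.map_comp_apply, ← Functor.map_comp_apply, prodLift_snd]
  rw [Functor.map_comp_apply, Functor.map_comp_apply] at h₃
  have h₄ := congrArg ((homotopyQuot F).map (mappingPathOrigin α β))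
    ((isAcyclicTower_mappingPathEnd α β hα hC).map_injective
      (fun p hp => homotopyQuot_map_injective hF p hp) h₃)
  rwa [← Functor.map_comp_apply, ← Functor.map_comp_apply, mappingPathConst_origin,
    Functor.map_id_apply, Functor.map_id_apply] at h₄

theorem isDeformation_homotopyQuot (hF : IsPredeformation F) : IsDeformation (homotopyQuot F) := by
  have hsurj : ∀ {A B : NilDGA K} (p : A ⟶ B), IsAcyclicSmallExtension p →
      Function.Surjective ((homotopyQuot F).map p) := by
    intro A B p hp y
    obtain ⟨b, rfl⟩ := toHomotopyQuot_surjective B y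
    obtain ⟨a, rfl⟩ := hF.quasismooth p hp b
    exact ⟨(toHomotopyQuot F).app A a, rfl⟩
  refine
    { zero := ?_
      fiber_surjective := homotopyQuot_fiber_surjective hF
      fiber_bijective := fun α β hα hC =>
        ⟨homotopyQuot_fiber_injective hF α β hα hC, homotopyQuot_fiber_surjective hF α β hα⟩
      quasismooth := hsurj
      bijective := fun p hp => ⟨homotopyQuot_map_injective hF p hp, hsurj p hp⟩ }
  obtain ⟨_⟩ := hF.zero
  refine ⟨⟨⟨(toHomotopyQuot F).app _ default⟩, fun x => ?_⟩⟩
  obtain ⟨a, rfl⟩ := toHomotopyQuot_surjective _ x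
  exact congrArg _ (Subsingleton.elim _ _)

/-- Homotopic elements of a deformation functor are equal. -/
theorem IsDeformation.eq_of_homotopic {G : NilDGA K ⥤ Type w} (hG : IsDeformation G)
    {A : NilDGA K} {a b : G.obj A} (h : Homotopic G A a b) : a = b := by
  obtain ⟨ε, hε, x, rfl, rfl⟩ := h
  -- Injectivity of `G(e_0)` makes its right inverse, given by the constants, a two-sided one.
  -- Evaluating at `1` a homotopy known to be constant then gives its value at `0`.
  have hx : G.map (pathConst A ε hε) (G.map (A.pathEval ε hε 0) x) = x := by
    refine (isAcyclicTower_pathEval A hε 0).map_injective (fun p hp => (hG.bijective p hp).1) ?_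
    rw [← Functor.map_comp_apply G (pathConst A ε hε), pathConst_eval, Functor.map_id_apply]
  conv_rhs => rw [← hx]
  rw [← Functor.map_comp_apply G (pathConst A ε hε), pathConst_eval, Functor.map_id_apply]

end NilDGA

end

/-! ### The universal property -/

theorem theorem2p8 {K : Type u} [Field K] [CharZero K] (F : NilDGA K ⥤ Type w)
    (hF : NilDGA.IsPredeformation F) :
    ∃ (F' : NilDGA K ⥤ Type w) (η : F ⟶ F'),
      NilDGA.IsDeformation F' ∧
      (∀ G : NilDGA K ⥤ Type w, NilDGA.IsDeformation G → ∀ φ : F ⟶ G,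
        ∃! ψ : F' ⟶ G, φ = η ≫ ψ) ∧
      ∀ A : NilDGA K, Function.Surjective (η.app A) ∧
        ∀ a b : F.obj A, η.app A a = η.app A b ↔
          Relation.EqvGen (NilDGA.Homotopic F A) a b := by
  refine ⟨NilDGA.homotopyQuot F, NilDGA.toHomotopyQuot F, NilDGA.isDeformation_homotopyQuot hF,
    fun G hG φ => ?_, fun A => ⟨NilDGA.toHomotopyQuot_surjective A,
      fun a b => NilDGA.toHomotopyQuot_eq_iff⟩⟩
  refine ⟨{ app := fun A => ↾(Quot.lift (φ.app A) fun a b h => hG.eq_of_homotopic (h.app φ))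
            naturality := fun A B f => ?_ }, ?_, fun ψ hψ => ?_⟩
  · ext ⟨a⟩
    exact NatTrans.naturality_apply φ f a
  · ext A a
    rfl
  · ext A ⟨a⟩
    exact (congrArg (fun χ : F ⟶ G => χ.app A a) hψ).symm
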